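/- Let $f_S$ be the risk-neutral density of a positive underlying price $S_T$ ($T>0$) with finite mean $F=\int s f_S(s)\,ds$ (the futures price), let $r\in\mathbb R$, and let $$O_0(K)=\begin{cases}e^{-rT}\int\max(s-K,0)f_S(s)\,ds, & K>F,\\ e^{-rT}\int\max(K-s,0)f_S(s)\,ds, & K\le F,\end{cases}$$ be the out-of-the-money option price. Fix $0<\alpha<\beta$. For integers $m\ge 1$ put $u_m=m\pi/\log(\beta/\alpha)$, $$\psi_m(s)=\frac{u_m}{s^2}\Big(\sin\big(u_m\log\tfrac s\alpha\big)-u_m\cos\big(u_m\log\tfrac s\alpha\big)\Big),\qquad D_m=e^{-rT}\cos\big(u_m\log\tfrac F\alpha\big)+\int_\alpha^\beta\psi_m(K)O_0(K)\,dK .$$ For $n\ge2$ let $\Delta_n=(\beta-\alpha)/(n-1)$ and $K_i=\alpha+(i-1)\Delta_n$, $i=1,\dots,n$. For each $n$ one observes $O(K_i)=O_0(K_i)+\varepsilon_i$, where $\varepsilon_1,\dots,\varepsilon_n$ (a triangular array, the dependence on $n$ being suppressed) are independent with $\mathbb E[\varepsilon_i]=0$, $\mathbb E[\varepsilon_i^2]=\sigma_i^2\in(0,\infty)$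 and $\mathbb E[\varepsilon_i^4]<\infty$. Let $w_1,\dots,w_n$ be the coefficients of a composite quadrature rule: the $n-1$ cells of the grid are cut into consecutive panels of $p$ cells (so $p$ divides $n-1$), and on a panel with nodes $x_0,\dots,x_p$ the integral of $g$ is replaced by $\Delta_n\sum_{j=0}^p c_j\,g(x_j)$, with fixed $c_0,\dots,c_p$. The rule has order $\iota\ge 1$ if $\sum_{j=0}^p c_j\,j^d=\int_0^p x^d\,dx$ for all integers $0\le d<\iota$. Examples are the left and right Riemann sums ($\iota=1$), the trapezoidal rule ($\iota=2$) and Simpson's 1/3 rule ($\iota=4$). Put $$\widehat D_m=e^{-rT}\cos\big(u_m\log\tfrac F\alpha\big)+\sum_{i=1}^n w_i\,\psi_m(K_i)\,O(K_i)\,\Delta_n .$$ Then, for a rule of order $\iota$, $m\ge1$, and $n\ge 2$ with $p\mid n-1$: 1. The bias is the discretization error: $\mathbb E[\widehat D_m-D_m]=\zeta^D_{m,n}:=\sum_{i=1}^n w_i\psi_m(K_i)O_0(K_i)\Delta_n-\int_\alpha^\beta\psi_m(K)O_0(K)\,dK$. 2. $|\zeta^D_{m,n}|\le C\,m^{2+\iota}/n^{\iota}$,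 with a constant $C$ that does not depend on $m$ and $n$. If $\iota>2$ this is claimed when $f_S$ is $C^{\iota-2}$ on $[\alpha,\beta]$, and for those $n$ for which the kink $F$ of $O_0$ is not in the interior of a panel (that is, $F\notin(\alpha,\beta)$ or $F$ is an end point of a panel); for $\iota\le2$ no further condition is needed. 3. If moreover the variances $\sigma_i^2$ are bounded away from $0$ and the fourth moments $\mathbb E[\varepsilon_i^4]$ are bounded, uniformly in $i$ and $n$, then, for fixed $m\ge1$ and $n\to\infty$ (with $p\mid n-1$), $$\frac{\widehat D_m-D_m}{\sigma_D(m)}\xrightarrow{d}\mathcal N(0,1),\qquad \sigma_D^2(m)=\sum_{i=1}^n w_i^2\,\psi_m^2(K_i)\,\sigma_i^2\,\Delta_n^2 .$$ -/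

import Mathlib

open MeasureTheory ProbabilityTheory Filter Topology

/-! ### Risk-neutral density and out-of-the-money option prices -/

/-- `f` is the risk-neutral density of a positive underlying price `S_T` with finite mean. -/
structure IsPriceDensity (f : ℝ → ℝ) : Prop where
  measurable : Measurable f
  nonneg : ∀ s, 0 ≤ f s
  support_pos : ∀ s ≤ 0, f s = 0
  integrable : Integrable f
  integral_eq_one : ∫ s, f s = 1
  integrable_mean : Integrable (fun s => s * f s)

/-- The futures price `F = E[S_T]` under the risk-neutral density `f`. -/
noncomputable def futuresPrice (f : ℝ → ℝ) : ℝ := ∫ s, s * f s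

/-- The call price `exp(-rT) E[max(S_T - K, 0)]`. -/
noncomputable def callPrice (f : ℝ → ℝ) (r T K : ℝ) : ℝ :=
  Real.exp (-(r * T)) * ∫ s, max (s - K) 0 * f s

/-- The put price `exp(-rT) E[max(K - S_T, 0)]`. -/
noncomputable def putPrice (f : ℝ → ℝ) (r T K : ℝ) : ℝ :=
  Real.exp (-(r * T)) * ∫ s, max (K - s) 0 * f s

open Classical in
/-- The price `O₀(K)` of the out-of-the-money option with strike `K`:
a call if `K > F`, a put if `K ≤ F`. -/
noncomputable def otmPrice (f : ℝ → ℝ) (r T K : ℝ) : ℝ :=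
  if futuresPrice f < K then callPrice f r T K else putPrice f r T K

/-! ### Implied cosine coefficients -/

/-- The frequency `u_m = m π / log (β / α)`. -/
noncomputable def cosFreq (α β : ℝ) (m : ℕ) : ℝ := m * Real.pi / Real.log (β / α)

/-- `ψ_m(s)`, the second derivative in `s` of `cos (u_m log (s / α))`. -/
noncomputable def psi (α β : ℝ) (m : ℕ) (s : ℝ) : ℝ :=
  cosFreq α β m / s ^ 2 *
    (Real.sin (cosFreq α β m * Real.log (s / α)) -
      cosFreq α β m * Real.cos (cosFreq α β m * Real.log (s / α)))

/-- The option-implied cosine coefficient `D_m`. -/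
noncomputable def cosCoeff (f : ℝ → ℝ) (r T α β : ℝ) (m : ℕ) : ℝ :=
  Real.exp (-(r * T)) * Real.cos (cosFreq α β m * Real.log (futuresPrice f / α)) +
    ∫ K in α..β, psi α β m K * otmPrice f r T K

/-! ### Equidistant strike grid -/

/-- The mesh `Δ_n = (β - α) / (n - 1)`. -/
noncomputable def mesh (α β : ℝ) (n : ℕ) : ℝ := (β - α) / ((n : ℝ) - 1)

/-- The strikes `K_i = α + (i - 1) Δ_n`, `i = 1, …, n`, so that `K_1 = α` and `K_n = β`. -/
noncomputable def strike (α β : ℝ) (n i : ℕ) : ℝ := α + ((i : ℝ) - 1) * mesh α β n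

/-! ### Quadrature rules -/

/-- A composite quadrature rule on an equidistant grid: the grid is cut into consecutive panels of
`p` cells each, and on every panel, with nodes `x_0, …, x_p` and mesh `h`, the integral of `g` is
replaced by `h * ∑ j ≤ p, c j * g x_j`. -/
structure QuadRule where
  /-- number of cells in a panel -/
  p : ℕ
  p_pos : 0 < p
  /-- coefficients on a panel; only `c 0, …, c p` matter -/
  c : ℕ → ℝ

namespace QuadRule

/-- The rule can be used on a grid with `n` nodes: the `n - 1` cells split into panels. -/
def Admissible (R : QuadRule) (n : ℕ) : Prop := 2 ≤ n ∧ R.p ∣ n - 1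

/-- The coefficient `w_i` of the composite rule with `n` nodes, `i = 1, …, n`: the sum of the
coefficients that node `i` receives as the `j`-th node of the `k`-th panel. -/
noncomputable def weight (R : QuadRule) (n i : ℕ) : ℝ :=
  ∑ k ∈ Finset.range ((n - 1) / R.p), ∑ j ∈ Finset.range (R.p + 1),
    if k * R.p + j + 1 = i then R.c j else 0

/-- The rule has error order `ι`: on a panel it integrates polynomials of degree less than `ι`
exactly. -/
def HasOrder (R : QuadRule) (ι : ℕ) : Prop :=
  ∀ d < ι, ∑ j ∈ Finset.range (R.p + 1), R.c j * (j : ℝ) ^ d = ∫ x in (0 : ℝ)..R.p, x ^ d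

/-- Left Riemann sum. -/
noncomputable def leftRiemann : QuadRule := ⟨1, one_pos, fun j => if j = 0 then 1 else 0⟩

/-- Right Riemann sum. -/
noncomputable def rightRiemann : QuadRule := ⟨1, one_pos, fun j => if j = 0 then 0 else 1⟩

/-- Trapezoidal rule. -/
noncomputable def trapezoid : QuadRule := ⟨1, one_pos, fun _ => 1 / 2⟩

/-- Simpson's 1/3 rule. -/
noncomputable def simpson : QuadRule := ⟨2, two_pos, fun j => if j = 1 then 4 / 3 else 1 / 3⟩

theorem leftRiemann_hasOrder : leftRiemann.HasOrder 1 := by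
  intro d hd
  interval_cases d
  simp [leftRiemann]

theorem rightRiemann_hasOrder : rightRiemann.HasOrder 1 := by
  intro d hd
  interval_cases d
  simp [rightRiemann, Finset.sum_range_succ]

theorem trapezoid_hasOrder : trapezoid.HasOrder 2 := by
  intro d hd
  interval_cases d <;> simp [trapezoid, Finset.sum_range_succ]

theorem simpson_hasOrder : simpson.HasOrder 4 := by
  intro d hd
  interval_cases d <;> simp [simpson, Finset.sum_range_succ, integral_pow] <;> norm_num

theorem weight_of_p_eq_one (R : QuadRule) (hp : R.p = 1) (n i : ℕ) (hi : i ∈ Finset.Icc 1 n) :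
    R.weight n i = (if i < n then R.c 0 else 0) + (if 1 < i then R.c 1 else 0) := by
  obtain ⟨h1, h2⟩ := Finset.mem_Icc.mp hi
  obtain ⟨q, rfl⟩ : ∃ q, i = q + 1 := ⟨i - 1, by omega⟩
  unfold weight
  simp only [hp, Finset.sum_range_succ, Finset.range_zero, Finset.sum_empty, Nat.div_one,
    zero_add, mul_one, Finset.sum_add_distrib, add_zero]
  congr 1
  · simp only [Nat.add_right_cancel_iff, Finset.sum_ite_eq', Finset.mem_range]
    exact if_congr (by omega) rfl rfl
  · rcases q with _ | q
    · simp
    · simp only [Nat.add_right_cancel_iff, Finset.sum_ite_eq', Finset.mem_range]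
      exact if_congr (by omega) rfl rfl

theorem leftRiemann_weight (n i : ℕ) (hi : i ∈ Finset.Icc 1 n) :
    leftRiemann.weight n i = if i = n then 0 else 1 := by
  obtain ⟨h1, h2⟩ := Finset.mem_Icc.mp hi
  rw [weight_of_p_eq_one _ rfl n i hi]
  rcases eq_or_lt_of_le h2 with h | h
  · simp [leftRiemann, h]
  · simp [leftRiemann, h, h.ne]

theorem rightRiemann_weight (n i : ℕ) (hi : i ∈ Finset.Icc 1 n) :
    rightRiemann.weight n i = if i = 1 then 0 else 1 := by
  obtain ⟨h1, h2⟩ := Finset.mem_Icc.mp hi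
  rw [weight_of_p_eq_one _ rfl n i hi]
  rcases eq_or_lt_of_le h1 with h | h
  · simp [rightRiemann, ← h]
  · simp [rightRiemann, h, h.ne']

theorem trapezoid_weight (n i : ℕ) (hn : 2 ≤ n) (hi : i ∈ Finset.Icc 1 n) :
    trapezoid.weight n i = if i = 1 ∨ i = n then 1 / 2 else 1 := by
  obtain ⟨h1, h2⟩ := Finset.mem_Icc.mp hi
  rw [weight_of_p_eq_one _ rfl n i hi]
  simp only [trapezoid]
  split_ifs <;> first | omega | norm_num

theorem simpson_weight (n i : ℕ) (hn : simpson.Admissible n) (hi : i ∈ Finset.Icc 1 n) :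
    simpson.weight n i = if i = 1 ∨ i = n then 1 / 3 else 1 / 3 * (3 + (-1) ^ i) := by
  obtain ⟨h1, h2⟩ := Finset.mem_Icc.mp hi
  obtain ⟨hn2, hd⟩ := hn
  have hp : simpson.p = 2 := rfl
  rw [hp] at hd
  obtain ⟨N, hN⟩ := hd
  obtain rfl : n = 2 * N + 1 := by omega
  unfold weight
  have h3 : (2 * N + 1 - 1) / 2 = N := by omega
  simp only [hp, Finset.sum_range_succ, Finset.range_zero, Finset.sum_empty, zero_add, h3, add_zero,
    Finset.sum_add_distrib]
  obtain ⟨q, hq | hq⟩ : ∃ q, i = 2 * q + 1 ∨ i = 2 * q + 2 := ⟨(i - 1) / 2, by omega⟩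
  · subst hq
    have e0 : ∀ k, (k * 2 + 1 = 2 * q + 1) ↔ k = q := fun k => by omega
    have e1 : ∀ k, (k * 2 + 1 + 1 = 2 * q + 1) ↔ False := fun k => ⟨fun h => by omega, False.elim⟩
    have e2 : ∀ k, (k * 2 + 2 + 1 = 2 * q + 1) ↔ k + 1 = q := fun k => by omega
    simp only [e0, e1, e2, if_false, Finset.sum_const_zero]
    have hs : ((-1 : ℝ)) ^ (2 * q + 1) = -1 := by simp [pow_succ, pow_mul]
    rw [hs]
    rcases q with _ | q
    · have : 0 < N := by omega
      simp [simpson, this]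
    · simp only [Nat.add_right_cancel_iff, Finset.sum_ite_eq', Finset.mem_range, simpson]
      split_ifs <;> first | omega | contradiction | norm_num
  · subst hq
    have e0 : ∀ k, (k * 2 + 1 = 2 * q + 2) ↔ False := fun k => ⟨fun h => by omega, False.elim⟩
    have e1 : ∀ k, (k * 2 + 1 + 1 = 2 * q + 2) ↔ k = q := fun k => by omega
    have e2 : ∀ k, (k * 2 + 2 + 1 = 2 * q + 2) ↔ False := fun k => ⟨fun h => by omega, False.elim⟩
    simp only [e0, e1, e2, if_false, Finset.sum_const_zero]
    have hs : ((-1 : ℝ)) ^ (2 * q + 2) = 1 := by simp [pow_succ, pow_mul]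
    rw [hs]
    simp only [Finset.sum_ite_eq', Finset.mem_range, simpson]
    split_ifs <;> first | omega | contradiction | norm_num

end QuadRule

/-! ### Observation errors -/

/-- The observation errors `ε n 1, …, ε n n` on the grid with `n` strikes have mean zero, positive
variances `(σ n i)²`, finite fourth moments, and are independent. -/
structure IsObservationError {Ω : ℕ → Type*} [∀ n, MeasurableSpace (Ω n)]
    (P : ∀ n, Measure (Ω n)) (ε : ∀ n, ℕ → Ω n → ℝ) (σ : ℕ → ℕ → ℝ) : Prop where
  memLp_four : ∀ n, ∀ i ∈ Finset.Icc 1 n, MemLp (ε n i) 4 (P n)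
  mean_zero : ∀ n, ∀ i ∈ Finset.Icc 1 n, ∫ ω, ε n i ω ∂P n = 0
  sigma_pos : ∀ n, ∀ i ∈ Finset.Icc 1 n, 0 < σ n i
  second_moment : ∀ n, ∀ i ∈ Finset.Icc 1 n, ∫ ω, ε n i ω ^ 2 ∂P n = σ n i ^ 2
  indep : ∀ n, iIndepFun (fun i : Finset.Icc 1 n => ε n i) (P n)

/-- The variances are bounded away from zero and the fourth moments are bounded, uniformly over
the triangular array of errors. -/
def UniformMoments {Ω : ℕ → Type*} [∀ n, MeasurableSpace (Ω n)]
    (P : ∀ n, Measure (Ω n)) (ε : ∀ n, ℕ → Ω n → ℝ) (σ : ℕ → ℕ → ℝ) : Prop :=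
  ∃ c M : ℝ, 0 < c ∧ ∀ n, ∀ i ∈ Finset.Icc 1 n,
    c ≤ σ n i ^ 2 ∧ ∫ ω, ε n i ω ^ 4 ∂P n ≤ M

/-! ### The estimator -/

/-- The observed price `O(K_i) = O₀(K_i) + ε_i` on the grid with `n` strikes. -/
noncomputable def observedPrice {Ω : Type*} (f : ℝ → ℝ) (r T α β : ℝ) (n : ℕ) (ε : ℕ → Ω → ℝ)
    (i : ℕ) (ω : Ω) : ℝ :=
  otmPrice f r T (strike α β n i) + ε i ω

/-- The estimator `D̂_m` computed from `n` observed prices. -/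
noncomputable def cosCoeffEst {Ω : Type*} (R : QuadRule) (f : ℝ → ℝ) (r T α β : ℝ) (m n : ℕ)
    (ε : ℕ → Ω → ℝ) (ω : Ω) : ℝ :=
  Real.exp (-(r * T)) * Real.cos (cosFreq α β m * Real.log (futuresPrice f / α)) +
    ∑ i ∈ Finset.Icc 1 n, R.weight n i * psi α β m (strike α β n i) *
      observedPrice f r T α β n ε i ω * mesh α β n

/-- The discretization error `ζ_{m,n}`: quadrature sum minus integral of `ψ_m O₀`. -/
noncomputable def discretizationError (R : QuadRule) (f : ℝ → ℝ) (r T α β : ℝ) (m n : ℕ) : ℝ :=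
  ∑ i ∈ Finset.Icc 1 n, R.weight n i * psi α β m (strike α β n i) *
      otmPrice f r T (strike α β n i) * mesh α β n -
    ∫ K in α..β, psi α β m K * otmPrice f r T K

/-- `σ_D(m)`, the square root of `∑ i, w_i² ψ_m(K_i)² σ_i² Δ_n²`. -/
noncomputable def estStd (R : QuadRule) (α β : ℝ) (m n : ℕ) (σ : ℕ → ℝ) : ℝ :=
  √(∑ i ∈ Finset.Icc 1 n, R.weight n i ^ 2 * psi α β m (strike α β n i) ^ 2 *
      σ i ^ 2 * mesh α β n ^ 2)

/-! ### Lyapunov's central limit theorem -/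

/-! The error of the estimator is a linear form in the noise, `∑ w_i ψ_m(K_i) Δ_n ε_i`, plus the
deterministic quadrature error of `ψ_m O₀`. As the noise is centred, the quadrature error is the
bias.

Size of the bias. Put-call parity gives `O₀(K) = e^{-rT} (E(K - S)⁺ - (K - F)⁺)`, so by Fubini the
quadrature error of `ψ_m O₀` is an average over `s` of the errors for the hinges `ψ_m(K) (K - s)⁺`,
minus the one for `s = F` (`quadError_psi_mul_otmPrice`). A hinge is affine on every panel except
the one with its kink. A Taylor polynomial on a smooth panel, which the rule integrates exactly,
leaves `m^{2+ι} h^{ι+1}` with mesh `h`, because each derivative of `ψ_m` costs a factor `m`. The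
kink panel costs `m³ h²` by the Lipschitz bound, which is affordable exactly when `ι ≤ 2`. All
bounds are uniform in `s`, so no regularity of the density is needed. For `ι > 2` the prices gain
two derivatives over the density, and on each panel `O₀` is a pure put or a pure call because `F` is
not inside a panel (`exists_abs_quadError_le_of_contDiffOn`).

Asymptotic normality. The variance is at least a constant times `h`: some position in the panel
carries a fixed non-zero weight, and the nodes in that position form a Riemann sum for `∫ ψ_m²`
(`exists_le_mesh_mul_sum_weight_sq`). Thus each summand divided by `σ_D` has third absolute moment
`O(h^{3/2})`. With `n h` bounded the Lyapunov sum is `O(√h)`, and bias over `σ_D` is also `O(√h)`.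
Lyapunov's theorem is proved by comparing characteristic functions factor by factor with Gaussian
ones. -/

theorem norm_prod_sub_prod_le_sum {ι : Type*} (s : Finset ι) (a b : ι → ℂ)
    (ha : ∀ i ∈ s, ‖a i‖ ≤ 1) (hb : ∀ i ∈ s, ‖b i‖ ≤ 1) :
    ‖∏ i ∈ s, a i - ∏ i ∈ s, b i‖ ≤ ∑ i ∈ s, ‖a i - b i‖ := by
  classical
  induction s using Finset.induction_on with
  | empty => simp
  | insert j s hj ih =>
    rw [Finset.prod_insert hj, Finset.prod_insert hj, Finset.sum_insert hj]
    have ih' := ih (fun i hi => ha i (Finset.mem_insert_of_mem hi))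
      (fun i hi => hb i (Finset.mem_insert_of_mem hi))
    have h1 : ‖∏ i ∈ s, a i‖ ≤ 1 := by
      rw [norm_prod]
      exact Finset.prod_le_one (fun _ _ => norm_nonneg _)
        fun i hi => ha i (Finset.mem_insert_of_mem hi)
    have h2 : ‖b j‖ ≤ 1 := hb j (Finset.mem_insert_self _ _)
    calc ‖a j * ∏ i ∈ s, a i - b j * ∏ i ∈ s, b i‖
        = ‖(a j - b j) * ∏ i ∈ s, a i + b j * (∏ i ∈ s, a i - ∏ i ∈ s, b i)‖ := by
          congr 1; ring
      _ ≤ ‖a j - b j‖ * ‖∏ i ∈ s, a i‖ + ‖b j‖ * ‖∏ i ∈ s, a i - ∏ i ∈ s, b i‖ := by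
          rw [← norm_mul, ← norm_mul]; exact norm_add_le _ _
      _ ≤ ‖a j - b j‖ * 1 + 1 * ∑ i ∈ s, ‖a i - b i‖ := by gcongr
      _ = _ := by ring

/-- For `|x| ≤ 1` this is the remainder of the exponential series; for `|x| ≥ 1` the terms `1, 1,
|x|, |x|² / 2` are each dominated by `|x|³`, which explains the generous constant. -/
theorem norm_cexp_mul_I_sub_taylor_two_le (x : ℝ) :
    ‖Complex.exp (x * Complex.I) - (1 + x * Complex.I - (x : ℂ) ^ 2 / 2)‖ ≤ 4 * |x| ^ 3 := by
  rcases le_total |x| 1 with hx | hx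
  · have h := Complex.exp_bound (x := x * Complex.I) (by simpa using hx) (n := 3) (by norm_num)
    have e : ∑ m ∈ Finset.range 3, ((x : ℂ) * Complex.I) ^ m / (m.factorial : ℂ)
        = 1 + x * Complex.I - (x : ℂ) ^ 2 / 2 := by
      simp [Finset.sum_range_succ, mul_pow, Nat.factorial]
      ring
    rw [e] at h
    refine h.trans ?_
    have : ‖(x : ℂ) * Complex.I‖ = |x| := by simp
    rw [this, mul_comm (4 : ℝ)]
    gcongr
    norm_num [Nat.factorial]
  · have h1 : ‖Complex.exp (x * Complex.I)‖ = 1 := Complex.norm_exp_ofReal_mul_I x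
    have h2 : ‖(1 + x * Complex.I - (x : ℂ) ^ 2 / 2 : ℂ)‖ ≤ 1 + |x| + |x| ^ 2 / 2 := by
      refine (norm_sub_le _ _).trans ?_
      have : ‖(x : ℂ) ^ 2 / 2‖ = |x| ^ 2 / 2 := by simp
      rw [this]
      gcongr
      refine (norm_add_le _ _).trans ?_
      simp
    refine (norm_sub_le _ _).trans ?_
    rw [h1]
    have h3 : |x| ≤ |x| ^ 3 := le_self_pow₀ hx (by norm_num)
    have h4 : |x| ^ 2 ≤ |x| ^ 3 := pow_le_pow_right₀ hx (by norm_num)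
    linarith

theorem abs_exp_neg_sub_one_add_le {y : ℝ} (hy : 0 ≤ y) : |Real.exp (-y) - (1 - y)| ≤ y ^ 2 := by
  have h1 : 1 - y ≤ Real.exp (-y) := by linarith [Real.add_one_le_exp (-y)]
  rw [abs_of_nonneg (by linarith), Real.exp_neg]
  have h2 : (Real.exp y)⁻¹ ≤ (1 + y)⁻¹ := by
    gcongr
    linarith [Real.add_one_le_exp y]
  -- Since `(1 + y)(1 - y + y²) = 1 + y³ ≥ 1`.
  have h3 : (1 + y)⁻¹ ≤ 1 - y + y ^ 2 := by
    rw [inv_le_iff_one_le_mul₀ (by positivity)]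
    nlinarith [pow_nonneg hy 3]
  linarith

section
variable {Ω : Type*} [MeasurableSpace Ω] {P : Measure Ω} [IsProbabilityMeasure P] {X : Ω → ℝ}

theorem integrable_abs_pow_of_memLp {n k : ℕ} (hX : MemLp X n P) (hk : k ≤ n) :
    Integrable (fun ω => |X ω| ^ k) P := by
  have := (hX.mono_exponent (p := k) (by exact_mod_cast hk)).integrable_norm_pow'
  simpa using this

theorem integrable_pow_of_memLp {n k : ℕ} (hX : MemLp X n P) (hk : k ≤ n) :
    Integrable (fun ω => X ω ^ k) P := by
  refine (integrable_abs_pow_of_memLp hX hk).mono (hX.1.pow k) (ae_of_all _ fun ω => ?_)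
  simp

/-- Second order expansion of the characteristic function of a centred variable. -/
theorem norm_charFun_sub_le (hX : MemLp X 3 P) (h0 : ∫ ω, X ω ∂P = 0) (t : ℝ) :
    ‖charFun (P.map X) t - (1 - ((t ^ 2 * ∫ ω, X ω ^ 2 ∂P : ℝ) : ℂ) / 2)‖ ≤
      4 * |t| ^ 3 * ∫ ω, |X ω| ^ 3 ∂P := by
  have hX' : MemLp X (3 : ℕ) P := by exact_mod_cast hX
  have i1 : Integrable X P := by simpa using integrable_pow_of_memLp hX' (k := 1) (by norm_num)
  have i2 := integrable_pow_of_memLp hX' (k := 2) (by norm_num)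
  have i3 := integrable_abs_pow_of_memLp hX' (k := 3) (by norm_num)
  have hm : AEMeasurable X P := hX.1.aemeasurable
  rw [charFun_apply_real, integral_map hm (by fun_prop)]
  have j1 : Integrable (fun ω => ((t * X ω : ℝ) : ℂ) * Complex.I) P :=
    ((i1.const_mul t).ofReal).mul_const _
  have j2 : Integrable (fun ω => ((t * X ω : ℝ) : ℂ) ^ 2 / 2) P := by
    have := ((i2.const_mul (t ^ 2)).ofReal (𝕜 := ℂ)).div_const 2
    refine this.congr (ae_of_all _ fun ω => ?_)
    simp
    ring
  have hexp : Integrable (fun ω => Complex.exp (((t * X ω : ℝ) : ℂ) * Complex.I)) P := by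
    refine Integrable.of_bound (C := 1) ?_ (ae_of_all _ fun ω => ?_)
    · exact AEMeasurable.aestronglyMeasurable (by fun_prop)
    · rw [Complex.norm_exp_ofReal_mul_I]
  have e1 : ∫ ω, ((1 : ℂ) + ((t * X ω : ℝ) : ℂ) * Complex.I - ((t * X ω : ℝ) : ℂ) ^ 2 / 2) ∂P =
      1 - ((t ^ 2 * ∫ ω, X ω ^ 2 ∂P : ℝ) : ℂ) / 2 := by
    have k1 : Integrable (fun ω => (1 : ℂ) + ((t * X ω : ℝ) : ℂ) * Complex.I) P :=
      (integrable_const (1 : ℂ)).add j1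
    rw [integral_sub k1 j2, integral_add (integrable_const _) j1,
      integral_mul_const, integral_div]
    have e2 : ∫ ω, ((t * X ω : ℝ) : ℂ) ∂P = 0 := by
      rw [integral_complex_ofReal, integral_const_mul, h0]; simp
    have e3 : ∫ ω, ((t * X ω : ℝ) : ℂ) ^ 2 ∂P = ((t ^ 2 * ∫ ω, X ω ^ 2 ∂P : ℝ) : ℂ) := by
      rw [← integral_const_mul, ← integral_complex_ofReal]
      congr 1 with ω
      push_cast
      ring
    rw [e2, e3]
    simp
  have e4 : ∀ ω, Complex.exp ((t : ℂ) * (X ω : ℂ) * Complex.I) =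
      Complex.exp (((t * X ω : ℝ) : ℂ) * Complex.I) := fun ω => by push_cast; rfl
  simp_rw [e4]
  rw [← e1, ← integral_sub hexp (by
    exact ((integrable_const (1 : ℂ)).add j1).sub j2), ← integral_const_mul]
  refine norm_integral_le_of_norm_le (i3.const_mul _) (ae_of_all _ fun ω => ?_)
  refine (norm_cexp_mul_I_sub_taylor_two_le (t * X ω)).trans (le_of_eq ?_)
  rw [abs_mul, mul_pow]
  ring

/-- With `v` the second moment, a tangent-line form of Jensen's inequality gives `v^{3/2} ≤ E|X|³`,
and `v² ≤ v^{3/2}` because `v ≤ 1`. It lets the quadratic error of the Gaussian factors be absorbed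
in the Lyapunov sum. -/
theorem sq_integral_sq_le_integral_abs_cube (hX : MemLp X 3 P) (h1 : ∫ ω, X ω ^ 2 ∂P ≤ 1) :
    (∫ ω, X ω ^ 2 ∂P) ^ 2 ≤ ∫ ω, |X ω| ^ 3 ∂P := by
  have hX' : MemLp X (3 : ℕ) P := by exact_mod_cast hX
  have i2 := integrable_pow_of_memLp hX' (k := 2) (by norm_num)
  have i3 := integrable_abs_pow_of_memLp hX' (k := 3) (by norm_num)
  set v := ∫ ω, X ω ^ 2 ∂P with hv
  have hv0 : 0 ≤ v := integral_nonneg fun ω => sq_nonneg _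
  have hs0 := Real.sqrt_nonneg v
  have hs := Real.sq_sqrt hv0
  set s := √v
  have hs1 : s ≤ 1 := Real.sqrt_le_one.mpr h1
  have : ∫ ω, (3 / 2 * s * X ω ^ 2 - s ^ 3 / 2) ∂P ≤ ∫ ω, |X ω| ^ 3 ∂P := by
    refine integral_mono ((i2.const_mul _).sub (integrable_const _)) i3 fun ω => ?_
    -- This product expands to `|x|³ - (3/2) s x² + s³ / 2`, the gap between `|x|³` and its tangent
    -- in the variable `x²` at `x² = s²`.
    have : 0 ≤ (|X ω| - s) ^ 2 * (|X ω| + s / 2) := by positivity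
    have h2 : X ω ^ 2 = |X ω| ^ 2 := (sq_abs _).symm
    simp only [h2]
    nlinarith
  rw [integral_sub (i2.const_mul _) (integrable_const _), integral_const_mul, ← hv] at this
  simp only [integral_const, probReal_univ, one_smul] at this
  refine le_trans ?_ this
  rw [← hs]
  nlinarith [pow_nonneg hs0 3]

end

/-- **Lyapunov's central limit theorem** for a triangular array of independent centred random
variables, with third moments and with a deterministic shift tending to zero. -/
theorem tendstoInDistribution_sum_add_of_lyapunov {κ : Type*} {l : Filter κ}
    [l.IsCountablyGenerated] {Ω : κ → Type*} [∀ n, MeasurableSpace (Ω n)]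
    (P : ∀ n, Measure (Ω n)) [∀ n, IsProbabilityMeasure (P n)]
    {J : κ → Type*} [∀ n, Fintype (J n)] (X : ∀ n, J n → Ω n → ℝ) (b : κ → ℝ)
    (hX : ∀ n j, MemLp (X n j) 3 (P n)) (hmean : ∀ n j, ∫ ω, X n j ω ∂P n = 0)
    (hindep : ∀ n, iIndepFun (X n) (P n))
    (hvar : ∀ᶠ n in l, ∑ j, ∫ ω, X n j ω ^ 2 ∂P n = 1)
    (hlyap : Tendsto (fun n => ∑ j, ∫ ω, |X n j ω| ^ 3 ∂P n) l (𝓝 0))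
    (hb : Tendsto b l (𝓝 0)) :
    TendstoInDistribution (fun n ω => ∑ j, X n j ω + b n) l (id : ℝ → ℝ) P
      (gaussianReal 0 1) where
  forall_aemeasurable n :=
    (Finset.aemeasurable_fun_sum _ fun j _ => (hX n j).1.aemeasurable).add_const _
  aemeasurable_limit := aemeasurable_id
  tendsto := by
    have hm n j : AEMeasurable (X n j) (P n) := (hX n j).1.aemeasurable
    have hms n : AEMeasurable (fun ω => ∑ j, X n j ω) (P n) :=
      Finset.aemeasurable_fun_sum _ fun j _ => hm n j
    have key (t : ℝ) : Tendsto (fun n => charFun ((P n).map fun ω => ∑ j, X n j ω + b n) t) l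
        (𝓝 (charFun (gaussianReal 0 1) t)) := by
      have e n : charFun ((P n).map fun ω => ∑ j, X n j ω + b n) t =
          (∏ j, charFun ((P n).map (X n j)) t) * Complex.exp ((b n * t : ℝ) * Complex.I) := by
        have : (P n).map (fun ω => ∑ j, X n j ω + b n) =
            ((P n).map fun ω => ∑ j, X n j ω).map (· + b n) := by
          rw [AEMeasurable.map_map_of_aemeasurable (by fun_prop) (hms n)]
          rfl
        rw [this, charFun_map_add_const,
          (hindep n).charFun_map_fun_sum_eq_prod (hm n), Finset.prod_apply]
        congr 4
        simp [mul_comm]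
      simp_rw [e]
      have hdrift : Tendsto (fun n => Complex.exp ((b n * t : ℝ) * Complex.I)) l (𝓝 1) := by
        have : Tendsto (fun n => b n * t) l (𝓝 0) := by simpa using hb.mul_const t
        have h2 : Continuous fun x : ℝ => Complex.exp ((x : ℂ) * Complex.I) := by fun_prop
        have h3 := (h2.tendsto 0).comp this
        simp only [Complex.ofReal_zero, zero_mul, Complex.exp_zero] at h3
        exact h3
      have hprod : Tendsto (fun n => ∏ j, charFun ((P n).map (X n j)) t) l
          (𝓝 (charFun (gaussianReal 0 1) t)) := by
        rw [tendsto_iff_norm_sub_tendsto_zero]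
        -- `4 |t|³` comes from expanding the characteristic functions, `t⁴` from expanding the
        -- Gaussian factors.
        have hlim : Tendsto (fun n => (4 * |t| ^ 3 + t ^ 4) * ∑ j, ∫ ω, |X n j ω| ^ 3 ∂P n) l
            (𝓝 0) := by simpa using hlyap.const_mul (4 * |t| ^ 3 + t ^ 4)
        refine squeeze_zero' (Eventually.of_forall fun n => norm_nonneg _) ?_ hlim
        filter_upwards [hvar] with n hn
        have hv0 j : 0 ≤ ∫ ω, X n j ω ^ 2 ∂P n := integral_nonneg fun ω => sq_nonneg _
        have hv1 j : ∫ ω, X n j ω ^ 2 ∂P n ≤ 1 := by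
          rw [← hn]
          exact Finset.single_le_sum (f := fun j => ∫ ω, X n j ω ^ 2 ∂P n)
            (fun i _ => hv0 i) (Finset.mem_univ j)
        -- As the variances sum to one, the Gaussian characteristic function factors along the same
        -- index set, so the two products can be compared by telescoping.
        have hg : charFun (gaussianReal 0 1) t =
            ∏ j, ((Real.exp (-(t ^ 2 * ∫ ω, X n j ω ^ 2 ∂P n) / 2) : ℝ) : ℂ) := by
          rw [← Complex.ofReal_prod, ← Real.exp_sum, ← Finset.sum_div, Finset.sum_neg_distrib,
            ← Finset.mul_sum, hn, charFun_gaussianReal]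
          simp [neg_div]
        rw [hg, Finset.mul_sum]
        refine (norm_prod_sub_prod_le_sum _ _ _ (fun j _ => ?_) fun j _ => ?_).trans
          (Finset.sum_le_sum fun j _ => ?_)
        · have := Measure.isProbabilityMeasure_map (hm n j)
          exact norm_charFun_le_one t
        · rw [Complex.norm_real, Real.norm_eq_abs, Real.abs_exp, Real.exp_le_one_iff]
          have := hv0 j
          have : 0 ≤ t ^ 2 * ∫ ω, X n j ω ^ 2 ∂P n := by positivity
          linarith
        · set v := ∫ ω, X n j ω ^ 2 ∂P n
          have h1 := norm_charFun_sub_le (hX n j) (hmean n j) t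
          have h2 := abs_exp_neg_sub_one_add_le (y := t ^ 2 * v / 2)
            (by have := hv0 j; positivity)
          have h3 := sq_integral_sq_le_integral_abs_cube (hX n j) (hv1 j)
          have h4 : ‖((Real.exp (-(t ^ 2 * v) / 2) : ℝ) : ℂ) - (1 - ((t ^ 2 * v : ℝ) : ℂ) / 2)‖ ≤
              t ^ 4 * v ^ 2 := by
            have : ((Real.exp (-(t ^ 2 * v) / 2) : ℝ) : ℂ) - (1 - ((t ^ 2 * v : ℝ) : ℂ) / 2) =
              ((Real.exp (-(t ^ 2 * v / 2)) - (1 - t ^ 2 * v / 2) : ℝ) : ℂ) := by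
              push_cast
              congr 2
              ring
            rw [this, Complex.norm_real, Real.norm_eq_abs]
            refine h2.trans ?_
            have : 0 ≤ t ^ 4 * v ^ 2 := by positivity
            nlinarith
          calc _ = ‖(charFun ((P n).map (X n j)) t - (1 - ((t ^ 2 * v : ℝ) : ℂ) / 2)) -
                (((Real.exp (-(t ^ 2 * v) / 2) : ℝ) : ℂ) - (1 - ((t ^ 2 * v : ℝ) : ℂ) / 2))‖ := by
                congr 1; ring
            _ ≤ 4 * |t| ^ 3 * ∫ ω, |X n j ω| ^ 3 ∂P n + t ^ 4 * v ^ 2 :=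
                (norm_sub_le _ _).trans (add_le_add h1 h4)
            _ ≤ _ := by
                rw [add_mul]
                gcongr
      simpa using hprod.mul hdrift
    -- Lévy's continuity theorem is applied along sequences, which suffices for a countably
    -- generated filter.
    refine Filter.tendsto_of_seq_tendsto fun u hu => ?_
    refine ProbabilityMeasure.tendsto_of_tendsto_charFun fun t => ?_
    have h := (key t).comp hu
    simp only [Measure.map_id]
    exact h

/-! ### Error of a composite quadrature rule -/

theorem mesh_pos {α β : ℝ} (hαβ : α < β) {n : ℕ} (hn : 2 ≤ n) : 0 < mesh α β n := by
  have : (2 : ℝ) ≤ n := by exact_mod_cast hn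
  exact div_pos (by linarith) (by linarith)

theorem mesh_le {α β : ℝ} (hαβ : α < β) {n : ℕ} (hn : 2 ≤ n) :
    mesh α β n ≤ 2 * (β - α) / n := by
  have : (2 : ℝ) ≤ n := by exact_mod_cast hn
  unfold mesh
  rw [div_le_div_iff₀ (by linarith) (by linarith)]
  nlinarith

theorem mesh_le_length {α β : ℝ} (hαβ : α < β) {n : ℕ} (hn : 2 ≤ n) : mesh α β n ≤ β - α := by
  have : (2 : ℝ) ≤ n := by exact_mod_cast hn
  exact div_le_self (by linarith) (by linarith)

theorem strike_mem_Icc {α β : ℝ} (hαβ : α < β) {n i : ℕ} (hn : 2 ≤ n) (hi : i ∈ Finset.Icc 1 n) :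
    strike α β n i ∈ Set.Icc α β := by
  obtain ⟨h1, h2⟩ := Finset.mem_Icc.mp hi
  have h1' : (1 : ℝ) ≤ i := by exact_mod_cast h1
  have h2' : (i : ℝ) ≤ n := by exact_mod_cast h2
  have hm := mesh_pos hαβ hn
  have hn' : (2 : ℝ) ≤ n := by exact_mod_cast hn
  have e : ((n : ℝ) - 1) * mesh α β n = β - α := by
    unfold mesh; field_simp [show (n : ℝ) - 1 ≠ 0 by linarith]
  unfold strike
  constructor <;> nlinarith

namespace QuadRule

variable (R : QuadRule)

/-- The quadrature sum on one panel minus the integral over the panel. -/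
noncomputable def panelError (g : ℝ → ℝ) (a h : ℝ) : ℝ :=
  h * ∑ j ∈ Finset.range (R.p + 1), R.c j * g (a + j * h) - ∫ x in a..a + R.p * h, g x

/-- The composite quadrature sum on the grid with `n` nodes minus the integral. -/
noncomputable def quadError (g : ℝ → ℝ) (α β : ℝ) (n : ℕ) : ℝ :=
  ∑ i ∈ Finset.Icc 1 n, R.weight n i * g (strike α β n i) * mesh α β n - ∫ x in α..β, g x

/-- The left end point of the `k`-th panel. -/
noncomputable def panelStart (α β : ℝ) (n k : ℕ) : ℝ := α + k * (R.p * mesh α β n)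

/-- Sum of the absolute coefficients on a panel plus the length of the panel. -/
noncomputable def coeffBound : ℝ := ∑ j ∈ Finset.range (R.p + 1), |R.c j| + R.p

theorem coeffBound_nonneg : 0 ≤ R.coeffBound := by
  unfold coeffBound; positivity

variable {R}

theorem Admissible.panels_mul {n : ℕ} (hn : R.Admissible n) : (n - 1) / R.p * R.p = n - 1 :=
  Nat.div_mul_cancel hn.2

theorem Admissible.panels_mul_mesh {α β : ℝ} {n : ℕ} (hn : R.Admissible n) :
    (((n - 1) / R.p : ℕ) : ℝ) * (R.p * mesh α β n) = β - α := by
  have h1 : (((n - 1) / R.p : ℕ) : ℝ) * R.p = n - 1 := by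
    rw [← Nat.cast_mul, hn.panels_mul, Nat.cast_sub (by have := hn.1; omega), Nat.cast_one]
  have hn' : (2 : ℝ) ≤ n := by exact_mod_cast hn.1
  rw [← mul_assoc, h1]
  unfold mesh
  field_simp [show (n : ℝ) - 1 ≠ 0 by linarith]

/-- A node shared by two panels collects a coefficient from each, so after exchanging the sums every
pair (panel, position) is counted exactly once. -/
theorem sum_weight_mul {n : ℕ} (hn : R.Admissible n) (G : ℕ → ℝ) :
    ∑ i ∈ Finset.Icc 1 n, R.weight n i * G i =
      ∑ k ∈ Finset.range ((n - 1) / R.p), ∑ j ∈ Finset.range (R.p + 1),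
        R.c j * G (k * R.p + j + 1) := by
  unfold weight
  simp_rw [Finset.sum_mul]
  rw [Finset.sum_comm]
  refine Finset.sum_congr rfl fun k hk => ?_
  rw [Finset.sum_comm]
  refine Finset.sum_congr rfl fun j hj => ?_
  have hmem : k * R.p + j + 1 ∈ Finset.Icc 1 n := by
    have h1 := hn.panels_mul
    have h2 := Finset.mem_range.mp hk
    have h3 := Finset.mem_range.mp hj
    have h4 : (k + 1) * R.p ≤ (n - 1) / R.p * R.p := Nat.mul_le_mul_right _ h2
    have h5 := hn.1
    rw [add_mul] at h4
    exact Finset.mem_Icc.mpr ⟨by omega, by omega⟩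
  simp_rw [ite_mul, zero_mul]
  rw [Finset.sum_ite_eq, if_pos hmem]

theorem strike_panel (α β : ℝ) (n k j : ℕ) :
    strike α β n (k * R.p + j + 1) = R.panelStart α β n k + j * mesh α β n := by
  unfold strike panelStart
  push_cast
  ring

theorem panelStart_succ (α β : ℝ) (n k : ℕ) :
    R.panelStart α β n (k + 1) = R.panelStart α β n k + R.p * mesh α β n := by
  unfold panelStart
  push_cast
  ring

theorem panel_subset {α β : ℝ} (hαβ : α < β) {n k : ℕ} (hn : R.Admissible n)
    (hk : k < (n - 1) / R.p) :
    Set.Icc (R.panelStart α β n k) (R.panelStart α β n k + R.p * mesh α β n) ⊆ Set.Icc α β := by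
  have hm := mesh_pos hαβ hn.1
  have h1 := hn.panels_mul_mesh (α := α) (β := β)
  have hk' : (k : ℝ) + 1 ≤ (((n - 1) / R.p : ℕ) : ℝ) := by exact_mod_cast hk
  have hp : 0 < R.p * mesh α β n := mul_pos (by exact_mod_cast R.p_pos) hm
  refine Set.Icc_subset_Icc ?_ ?_
  · unfold panelStart
    have : 0 ≤ (k : ℝ) * (R.p * mesh α β n) := by positivity
    linarith
  · unfold panelStart
    nlinarith

theorem quadError_eq_sum_panelError {α β : ℝ} (hαβ : α < β) {n : ℕ} (hn : R.Admissible n)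
    {g : ℝ → ℝ} (hg : ContinuousOn g (Set.Icc α β)) :
    R.quadError g α β n = ∑ k ∈ Finset.range ((n - 1) / R.p),
      R.panelError g (R.panelStart α β n k) (mesh α β n) := by
  have hm := mesh_pos hαβ hn.1
  unfold quadError panelError
  rw [Finset.sum_sub_distrib]
  congr 1
  · rw [← Finset.sum_mul, sum_weight_mul hn (fun i => g (strike α β n i)), Finset.sum_mul]
    refine Finset.sum_congr rfl fun k _ => ?_
    rw [mul_comm]
    simp_rw [strike_panel]
  · have h0 : R.panelStart α β n 0 = α := by simp [panelStart]
    have h1 : R.panelStart α β n ((n - 1) / R.p) = β := by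
      unfold panelStart
      rw [hn.panels_mul_mesh]
      ring
    simp_rw [← panelStart_succ]
    rw [intervalIntegral.sum_integral_adjacent_intervals, h0, h1]
    intro k hk
    refine ContinuousOn.intervalIntegrable (hg.mono ?_)
    rw [panelStart_succ, Set.uIcc_of_le (by
      have : 0 ≤ (R.p : ℝ) * mesh α β n := by positivity
      linarith)]
    exact panel_subset hαβ hn hk

theorem panelError_congr {g₁ g₂ : ℝ → ℝ} {a h : ℝ} (hh : 0 ≤ h)
    (heq : Set.EqOn g₁ g₂ (Set.Icc a (a + R.p * h))) :
    R.panelError g₁ a h = R.panelError g₂ a h := by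
  unfold panelError
  congr 1
  · congr 1
    refine Finset.sum_congr rfl fun j hj => ?_
    have : (j : ℝ) ≤ R.p := by exact_mod_cast Nat.lt_succ_iff.mp (Finset.mem_range.mp hj)
    rw [heq ⟨by nlinarith [(Nat.cast_nonneg j : (0 : ℝ) ≤ j)], by nlinarith⟩]
  · refine intervalIntegral.integral_congr ?_
    rwa [Set.uIcc_of_le (by have : 0 ≤ (R.p : ℝ) * h := by positivity
                            linarith)]

theorem panelError_sub {g₁ g₂ : ℝ → ℝ} {a h : ℝ}
    (h₁ : IntervalIntegrable g₁ volume a (a + R.p * h))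
    (h₂ : IntervalIntegrable g₂ volume a (a + R.p * h)) :
    R.panelError (fun x => g₁ x - g₂ x) a h = R.panelError g₁ a h - R.panelError g₂ a h := by
  unfold panelError
  rw [intervalIntegral.integral_sub h₁ h₂]
  simp_rw [mul_sub, Finset.sum_sub_distrib]
  ring

theorem panelError_const_mul (s : ℝ) (g : ℝ → ℝ) (a h : ℝ) :
    R.panelError (fun x => s * g x) a h = s * R.panelError g a h := by
  unfold panelError
  rw [intervalIntegral.integral_const_mul]
  simp_rw [mul_left_comm _ s, ← Finset.mul_sum]
  ring

theorem abs_panelError_le_of_bound {g : ℝ → ℝ} {a h B : ℝ} (hh : 0 ≤ h)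
    (hB : ∀ x ∈ Set.Icc a (a + R.p * h), |g x| ≤ B) :
    |R.panelError g a h| ≤ B * h * R.coeffBound := by
  have hph : 0 ≤ (R.p : ℝ) * h := by positivity
  have h1 : |∫ x in a..a + R.p * h, g x| ≤ B * (R.p * h) := by
    have := intervalIntegral.norm_integral_le_of_norm_le_const (f := g) (C := B)
      (a := a) (b := a + R.p * h) (fun x hx => by
        rw [Set.uIoc_of_le (by linarith)] at hx
        exact hB x (Set.Ioc_subset_Icc_self hx))
    rwa [add_sub_cancel_left, abs_of_nonneg hph] at this
  have h2 : |∑ j ∈ Finset.range (R.p + 1), R.c j * g (a + j * h)| ≤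
      (∑ j ∈ Finset.range (R.p + 1), |R.c j|) * B := by
    rw [Finset.sum_mul]
    refine (Finset.abs_sum_le_sum_abs _ _).trans (Finset.sum_le_sum fun j hj => ?_)
    rw [abs_mul]
    gcongr
    have : (j : ℝ) ≤ R.p := by exact_mod_cast Nat.lt_succ_iff.mp (Finset.mem_range.mp hj)
    exact hB _ ⟨by nlinarith [(Nat.cast_nonneg j : (0 : ℝ) ≤ j)], by nlinarith⟩
  unfold panelError coeffBound
  calc _ ≤ |h * ∑ j ∈ Finset.range (R.p + 1), R.c j * g (a + j * h)| +
        |∫ x in a..a + R.p * h, g x| := abs_sub _ _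
    _ ≤ h * ((∑ j ∈ Finset.range (R.p + 1), |R.c j|) * B) + B * (R.p * h) := by
        rw [abs_mul, abs_of_nonneg hh]
        gcongr
    _ = _ := by ring

/-- The substitution `x = a + h t` turns the error for `(x - a)^d` into `h^{d+1}` times the defect
of the rule for `t^d` on `[0, p]`, which is zero for `d < ι`. -/
theorem HasOrder.panelError_polynomial {ι : ℕ} (hR : R.HasOrder ι) (b : ℕ → ℝ) (a h : ℝ) :
    R.panelError (fun x => ∑ d ∈ Finset.range ι, b d * (x - a) ^ d) a h = 0 := by
  unfold panelError
  rw [intervalIntegral.integral_finsetSum (fun d _ => by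
    apply Continuous.intervalIntegrable; fun_prop)]
  simp_rw [Finset.mul_sum]
  rw [Finset.sum_comm, ← Finset.sum_sub_distrib]
  refine Finset.sum_eq_zero fun d hd => ?_
  have h1 := hR d (Finset.mem_range.mp hd)
  rw [intervalIntegral.integral_const_mul, intervalIntegral.integral_comp_sub_right
    (fun x => x ^ d), integral_pow]
  rw [integral_pow] at h1
  have h2 : ∑ j ∈ Finset.range (R.p + 1), h * (R.c j * (b d * (a + j * h - a) ^ d)) =
      h ^ (d + 1) * b d * ∑ j ∈ Finset.range (R.p + 1), R.c j * (j : ℝ) ^ d := by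
    rw [Finset.mul_sum]
    refine Finset.sum_congr rfl fun j _ => ?_
    rw [add_sub_cancel_left, mul_pow]
    ring
  rw [h2, h1, add_sub_cancel_left, sub_self, mul_pow]
  simp
  ring

/-- Subtracting a polynomial of degree below `ι` does not change the panel error, so only the
distance of `g` to such polynomials matters. -/
theorem HasOrder.abs_panelError_le {ι : ℕ} (hR : R.HasOrder ι) {g : ℝ → ℝ} {a h B : ℝ}
    (hh : 0 ≤ h) (hg : ContinuousOn g (Set.Icc a (a + R.p * h))) (b : ℕ → ℝ)
    (hB : ∀ x ∈ Set.Icc a (a + R.p * h),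
      |g x - ∑ d ∈ Finset.range ι, b d * (x - a) ^ d| ≤ B) :
    |R.panelError g a h| ≤ B * h * R.coeffBound := by
  have h0 : a ≤ a + R.p * h := by
    have : 0 ≤ (R.p : ℝ) * h := by positivity
    linarith
  have h1 := abs_panelError_le_of_bound hh hB
  rwa [panelError_sub (hg.intervalIntegrable_of_Icc h0)
    (by apply Continuous.intervalIntegrable; fun_prop), hR.panelError_polynomial, sub_zero] at h1

theorem HasOrder.mono {ι κ : ℕ} (hR : R.HasOrder ι) (h : κ ≤ ι) : R.HasOrder κ :=
  fun d hd => hR d (hd.trans_le h)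

theorem HasOrder.abs_panelError_le_of_lipschitz (hR : R.HasOrder 1) {g : ℝ → ℝ} {a h L : ℝ}
    (hh : 0 ≤ h) (hL : 0 ≤ L) (hg : ContinuousOn g (Set.Icc a (a + R.p * h)))
    (hlip : ∀ x ∈ Set.Icc a (a + R.p * h), ∀ y ∈ Set.Icc a (a + R.p * h),
      |g x - g y| ≤ L * |x - y|) :
    |R.panelError g a h| ≤ R.p * R.coeffBound * L * h ^ 2 := by
  have h0 : 0 ≤ (R.p : ℝ) * h := by positivity
  refine (hR.abs_panelError_le (B := L * (R.p * h)) hh hg (fun _ => g a) fun x hx => ?_).trans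
    (le_of_eq (by ring))
  have := hlip x hx a ⟨le_rfl, by linarith⟩
  simp only [Finset.range_one, Finset.sum_singleton, pow_zero, mul_one]
  refine this.trans ?_
  gcongr
  rw [abs_of_nonneg (by linarith [hx.1])]
  linarith [hx.2]

/-- The comparison polynomial is the Taylor polynomial at the left end of the panel, whose remainder
is at most `M (p h)^ι`. -/
theorem HasOrder.abs_panelError_le_of_contDiffOn {ι : ℕ} (hι : 1 ≤ ι) (hR : R.HasOrder ι)
    {g : ℝ → ℝ} {a h α β M : ℝ} (hαβ : α < β) (hh : 0 < h)
    (hsub : Set.Icc a (a + R.p * h) ⊆ Set.Icc α β) (hg : ContDiffOn ℝ ι g (Set.Icc α β))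
    (hM : ∀ x ∈ Set.Icc α β, |iteratedDerivWithin ι g (Set.Icc α β) x| ≤ M) :
    |R.panelError g a h| ≤ R.p ^ ι * R.coeffBound * M * h ^ (ι + 1) := by
  obtain ⟨κ, rfl⟩ : ∃ κ, ι = κ + 1 := ⟨ι - 1, by omega⟩
  have hp : (0 : ℝ) < R.p := by exact_mod_cast R.p_pos
  have h0 : a < a + R.p * h := by
    have : 0 < (R.p : ℝ) * h := by positivity
    linarith
  have hg' := hg.mono hsub
  have hM0 : 0 ≤ M := (abs_nonneg _).trans (hM α ⟨le_rfl, hαβ.le⟩)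
  refine (hR.abs_panelError_le (B := M * (R.p * h) ^ (κ + 1)) hh.le hg'.continuousOn
    (fun d => ((d.factorial : ℝ)⁻¹ * iteratedDerivWithin d g (Set.Icc a (a + R.p * h)) a))
    fun x hx => ?_).trans (le_of_eq (by rw [mul_pow]; ring))
  have ht := taylor_mean_remainder_bound (f := g) (C := M) (n := κ) h0.le
    (by exact_mod_cast hg') hx fun y hy => by
      -- The one-sided derivatives on the panel agree with those on `[α, β]`, so `M` serves all
      -- panels.
      have : iteratedDerivWithin (κ + 1) g (Set.Icc a (a + R.p * h)) y =
          iteratedDerivWithin (κ + 1) g (Set.Icc α β) y := by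
        unfold iteratedDerivWithin
        rw [iteratedFDerivWithin_subset hsub (uniqueDiffOn_Icc h0) (uniqueDiffOn_Icc hαβ)
          hg hy]
      rw [this]
      exact hM y (hsub hy)
  rw [taylor_within_apply] at ht
  have e : ∑ d ∈ Finset.range (κ + 1), (d.factorial : ℝ)⁻¹ *
      iteratedDerivWithin d g (Set.Icc a (a + R.p * h)) a * (x - a) ^ d =
      ∑ d ∈ Finset.range (κ + 1), ((d.factorial : ℝ)⁻¹ * (x - a) ^ d) •
      iteratedDerivWithin d g (Set.Icc a (a + R.p * h)) a := by
    refine Finset.sum_congr rfl fun d _ => ?_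
    rw [smul_eq_mul]
    ring
  rw [e]
  refine ht.trans ?_
  have hx1 : 0 ≤ x - a := by linarith [hx.1]
  refine (div_le_self (by positivity)
    (by exact_mod_cast Nat.succ_le_of_lt (Nat.factorial_pos κ))).trans ?_
  gcongr
  linarith [hx.2]

end QuadRule

/-! ### Derivatives of `ψ_m` -/

/-- `(A sin (u log (x / α)) + B cos (u log (x / α))) / x ^ j`. -/
noncomputable def logTrig (α u A B : ℝ) (j : ℕ) (x : ℝ) : ℝ :=
  (A * Real.sin (u * Real.log (x / α)) + B * Real.cos (u * Real.log (x / α))) / x ^ j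

/-- The family is closed under differentiation: the coefficients change linearly and the power of
`x` rises by one. This avoids explicit formulas for higher derivatives of `ψ_m`. -/
theorem hasDerivAt_logTrig {α : ℝ} (hα : 0 < α) (u A B : ℝ) (j : ℕ) {x : ℝ} (hx : 0 < x) :
    HasDerivAt (logTrig α u A B j) (logTrig α u (-(j * A) - u * B) (u * A - j * B) (j + 1) x) x := by
  have h1 : HasDerivAt (fun x => u * Real.log (x / α)) (u * (1 / α / (x / α))) x :=
    (((hasDerivAt_id x).div_const α).log (div_pos hx hα).ne').const_mul u
  have h2 := ((h1.sin.const_mul A).add (h1.cos.const_mul B)).div (hasDerivAt_pow j x)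
    (pow_pos hx j).ne'
  refine h2.congr_deriv ?_
  unfold logTrig
  simp only [Pi.add_apply]
  rcases j with _ | j
  · field_simp
    simp
    ring
  · simp only [Nat.add_sub_cancel]
    field_simp
    push_cast
    ring

theorem contDiffOn_logTrig {α : ℝ} (hα : 0 < α) (u A B : ℝ) (j : ℕ) (n : WithTop ℕ∞)
    {S : Set ℝ} (hS : S ⊆ Set.Ioi 0) : ContDiffOn ℝ n (logTrig α u A B j) S := by
  have h1 : ContDiffOn ℝ n (fun x => u * Real.log (x / α)) S :=
    contDiffOn_const.mul ((contDiffOn_id.div_const α).log fun x hx => (div_pos (hS hx) hα).ne')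
  exact ((contDiffOn_const.mul h1.sin).add (contDiffOn_const.mul h1.cos)).div
    (contDiffOn_id.pow j) fun x hx => (pow_pos (hS hx) j).ne'

theorem abs_logTrig_le (α u A B : ℝ) (j : ℕ) {x : ℝ} (hx : 0 < x) :
    |logTrig α u A B j x| ≤ (|A| + |B|) / x ^ j := by
  unfold logTrig
  rw [abs_div, abs_of_pos (pow_pos hx j)]
  gcongr
  refine (abs_add_le _ _).trans ?_
  rw [abs_mul, abs_mul]
  refine add_le_add (mul_le_of_le_one_right (abs_nonneg _) (Real.abs_sin_le_one _))
    (mul_le_of_le_one_right (abs_nonneg _) (Real.abs_cos_le_one _))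

/-- One differentiation multiplies `|A| + |B|` by at most `j + |u|`; over `k` steps the exponent
stays below `j + k`. The coefficients are quantified inside the induction since each step changes
them. -/
theorem exists_iteratedDerivWithin_logTrig {α : ℝ} (hα : 0 < α) (u : ℝ) {S : Set ℝ}
    (hS : S ⊆ Set.Ioi 0) (hu : UniqueDiffOn ℝ S) (k : ℕ) : ∀ (A B : ℝ) (j : ℕ), ∃ A' B' : ℝ,
      |A'| + |B'| ≤ (j + k + |u|) ^ k * (|A| + |B|) ∧
      ∀ x ∈ S, iteratedDerivWithin k (logTrig α u A B j) S x = logTrig α u A' B' (j + k) x := by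
  induction k with
  | zero => exact fun A B j => ⟨A, B, by simp, fun x _ => by simp⟩
  | succ k ih =>
    intro A B j
    obtain ⟨A', B', h1, h2⟩ := ih (-(j * A) - u * B) (u * A - j * B) (j + 1)
    refine ⟨A', B', h1.trans ?_, fun x hx => ?_⟩
    · have h3 : |-(j * A) - u * B| ≤ j * |A| + |u| * |B| := by
        refine (abs_sub _ _).trans ?_
        rw [abs_neg, abs_mul, abs_mul, Nat.abs_cast]
      have h4 : |u * A - j * B| ≤ |u| * |A| + j * |B| := by
        refine (abs_sub _ _).trans ?_
        rw [abs_mul, abs_mul, Nat.abs_cast]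
      calc _ ≤ (((j + 1 : ℕ) : ℝ) + k + |u|) ^ k * ((j + (k + 1) + |u|) * (|A| + |B|)) := by
            gcongr
            have : (0 : ℝ) ≤ (k + 1) * (|A| + |B|) := by positivity
            nlinarith
        _ = _ := by push_cast; ring
    · rw [iteratedDerivWithin_succ', show j + (k + 1) = j + 1 + k by ring, ← h2 x hx]
      refine iteratedDerivWithin_congr (fun y hy => ?_) hx
      exact (hasDerivAt_logTrig hα u A B j (hS hy)).hasDerivWithinAt.derivWithin (hu y hy)

theorem psi_eq_logTrig (α β : ℝ) (m : ℕ) :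
    psi α β m = logTrig α (cosFreq α β m) (cosFreq α β m) (-cosFreq α β m ^ 2) 2 := by
  ext x
  unfold psi logTrig
  ring

theorem cosFreq_eq_mul (α β : ℝ) (m : ℕ) : cosFreq α β m = m * cosFreq α β 1 := by
  unfold cosFreq
  push_cast
  ring

theorem cosFreq_pos {α β : ℝ} (hα : 0 < α) (hαβ : α < β) {m : ℕ} (hm : 0 < m) :
    0 < cosFreq α β m := by
  have h1 : 0 < Real.log (β / α) := Real.log_pos ((one_lt_div hα).mpr hαβ)
  have h2 : (0 : ℝ) < m := by exact_mod_cast hm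
  unfold cosFreq
  have := Real.pi_pos
  positivity

theorem Icc_subset_Ioi_zero {α β : ℝ} (hα : 0 < α) : Set.Icc α β ⊆ Set.Ioi 0 :=
  fun _ hx => hα.trans_le hx.1

theorem contDiffOn_psi {α : ℝ} (hα : 0 < α) (β : ℝ) (m : ℕ) (n : WithTop ℕ∞) :
    ContDiffOn ℝ n (psi α β m) (Set.Icc α β) := by
  rw [psi_eq_logTrig]
  exact contDiffOn_logTrig hα _ _ _ _ _ (Icc_subset_Ioi_zero hα)

theorem continuousOn_psi {α : ℝ} (hα : 0 < α) (β : ℝ) (m : ℕ) :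
    ContinuousOn (psi α β m) (Set.Icc α β) :=
  (contDiffOn_psi hα β m 0).continuousOn

/-- As `u_m = m u_1`, the amplitude `u_m + u_m²` of `ψ_m` costs `m²` and each derivative costs one
more `m`. -/
theorem exists_abs_iteratedDerivWithin_psi_le {α β : ℝ} (hα : 0 < α) (hαβ : α < β) (k : ℕ) :
    ∃ C : ℝ, 0 ≤ C ∧ ∀ m : ℕ, 0 < m → ∀ x ∈ Set.Icc α β,
      |iteratedDerivWithin k (psi α β m) (Set.Icc α β) x| ≤ C * (m : ℝ) ^ (2 + k) := by
  have hu1 : 0 < cosFreq α β 1 := cosFreq_pos hα hαβ one_pos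
  set v := cosFreq α β 1
  refine ⟨(2 + k + v) ^ k * (v + v ^ 2) / α ^ (2 + k), by positivity, fun m hm x hx => ?_⟩
  have hx0 : 0 < x := hα.trans_le hx.1
  have hm1 : (1 : ℝ) ≤ m := by exact_mod_cast hm
  have hu : cosFreq α β m = m * v := cosFreq_eq_mul α β m
  have hup := cosFreq_pos hα hαβ hm
  rw [psi_eq_logTrig]
  obtain ⟨A', B', h1, h2⟩ := exists_iteratedDerivWithin_logTrig hα (cosFreq α β m)
    (Icc_subset_Ioi_zero hα) (uniqueDiffOn_Icc hαβ) k (cosFreq α β m) (-cosFreq α β m ^ 2) 2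
  rw [h2 x hx]
  refine (abs_logTrig_le _ _ _ _ _ hx0).trans ?_
  calc (|A'| + |B'|) / x ^ (2 + k)
      ≤ ((m * (2 + k + v)) ^ k * (m ^ 2 * (v + v ^ 2))) / α ^ (2 + k) := by
        gcongr
        · refine h1.trans ?_
          rw [abs_neg, abs_of_pos hup, abs_of_nonneg (sq_nonneg _), hu]
          push_cast
          gcongr
          · nlinarith
          · nlinarith [mul_nonneg (sub_nonneg.mpr hm1) (by positivity : 0 ≤ m * v)]
        · exact hx.1
    _ = _ := by rw [mul_pow]; ring

theorem exists_abs_psi_le {α β : ℝ} (hα : 0 < α) (hαβ : α < β) :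
    ∃ C : ℝ, 0 ≤ C ∧ ∀ m : ℕ, 0 < m → ∀ x ∈ Set.Icc α β,
      |psi α β m x| ≤ C * (m : ℝ) ^ 2 := by
  obtain ⟨C, h0, h⟩ := exists_abs_iteratedDerivWithin_psi_le hα hαβ 0
  exact ⟨C, h0, fun m hm x hx => by simpa using h m hm x hx⟩

theorem exists_lipschitz_psi {α β : ℝ} (hα : 0 < α) (hαβ : α < β) :
    ∃ C : ℝ, 0 ≤ C ∧ ∀ m : ℕ, 0 < m → ∀ x ∈ Set.Icc α β, ∀ y ∈ Set.Icc α β,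
      |psi α β m x - psi α β m y| ≤ C * (m : ℝ) ^ 3 * |x - y| := by
  obtain ⟨C, h0, h⟩ := exists_abs_iteratedDerivWithin_psi_le hα hαβ 1
  refine ⟨C, h0, fun m hm x hx y hy => ?_⟩
  refine (convex_Icc α β).norm_image_sub_le_of_norm_derivWithin_le
    ((contDiffOn_psi hα β m 1).differentiableOn (by norm_num)) (fun z hz => ?_) hy hx
  have := h m hm z hz
  rwa [iteratedDerivWithin_one] at this

theorem psi_left_ne_zero {α β : ℝ} (hα : 0 < α) (hαβ : α < β) {m : ℕ} (hm : 0 < m) :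
    psi α β m α ≠ 0 := by
  have := cosFreq_pos hα hαβ hm
  unfold psi
  rw [div_self hα.ne', Real.log_one, mul_zero, Real.sin_zero, Real.cos_zero]
  have h2 : 0 < cosFreq α β m / α ^ 2 := by positivity
  nlinarith [mul_pos h2 this]

/-- Leibniz bound for the derivatives of `ψ_m g` in terms of the order of differentiation. -/
theorem exists_abs_iteratedDerivWithin_psi_mul_le {α β : ℝ} (hα : 0 < α) (hαβ : α < β) {k : ℕ}
    {g : ℝ → ℝ} (hg : ContDiffOn ℝ k g (Set.Icc α β)) :
    ∃ C : ℝ, 0 ≤ C ∧ ∀ m : ℕ, 0 < m → ∀ x ∈ Set.Icc α β,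
      |iteratedDerivWithin k (fun y => psi α β m y * g y) (Set.Icc α β) x| ≤
        C * (m : ℝ) ^ (2 + k) := by
  choose C hC0 hC using fun i => exists_abs_iteratedDerivWithin_psi_le hα hαβ i
  have hbd : ∀ i ∈ Finset.range (k + 1), ∃ D : ℝ, ∀ x ∈ Set.Icc α β,
      |iteratedDerivWithin (k - i) g (Set.Icc α β) x| ≤ D := fun i _ => by
    have hc : ContinuousOn (iteratedDerivWithin (k - i) g (Set.Icc α β)) (Set.Icc α β) :=
      hg.continuousOn_iteratedDerivWithin (by exact_mod_cast Nat.sub_le k i)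
        (uniqueDiffOn_Icc hαβ)
    exact isCompact_Icc.exists_bound_of_continuousOn hc
  choose! D hD using hbd
  have hD0 : ∀ i ∈ Finset.range (k + 1), 0 ≤ D i := fun i hi =>
    (abs_nonneg _).trans (hD i hi α ⟨le_rfl, hαβ.le⟩)
  refine ⟨∑ i ∈ Finset.range (k + 1), k.choose i * C i * D i,
    Finset.sum_nonneg fun i hi => by have := hC0 i; have := hD0 i hi; positivity,
    fun m hm x hx => ?_⟩
  have hm1 : (1 : ℝ) ≤ m := by exact_mod_cast hm
  have h := iteratedDerivWithin_mul hx (uniqueDiffOn_Icc hαβ) (n := k)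
    ((contDiffOn_psi hα β m k) x hx) (hg x hx)
  rw [show (fun y => psi α β m y * g y) = psi α β m * g from rfl, h, Finset.sum_mul]
  refine (Finset.abs_sum_le_sum_abs _ _).trans (Finset.sum_le_sum fun i hi => ?_)
  rw [abs_mul, abs_mul, Nat.abs_cast]
  have h1 : (m : ℝ) ^ (2 + i) ≤ (m : ℝ) ^ (2 + k) :=
    pow_le_pow_right₀ hm1 (by have := Finset.mem_range.mp hi; omega)
  have := hC0 i
  have := hD0 i hi
  calc _ ≤ k.choose i * (C i * (m : ℝ) ^ (2 + k)) * D i := by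
        gcongr
        · exact (hC i m hm x hx).trans (by gcongr)
        · exact hD i hi x hx
    _ = _ := by ring

/-! ### Out-of-the-money prices as mixtures of hinge functions -/

namespace IsPriceDensity

variable {f : ℝ → ℝ}

theorem integrable_hinge_mul (hf : IsPriceDensity f) (K : ℝ) :
    Integrable (fun s => max (K - s) 0 * f s) := by
  have hm := hf.measurable
  refine (hf.integrable.const_mul |K|).mono' (by fun_prop) (ae_of_all _ fun s => ?_)
  have h0 := hf.nonneg s
  rcases le_or_gt s 0 with hs | hs
  · simp [hf.support_pos s hs]
  · rw [Real.norm_eq_abs, abs_mul, abs_of_nonneg h0, abs_of_nonneg (le_max_right _ _)]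
    gcongr
    exact max_le (by linarith [le_abs_self K]) (abs_nonneg K)

theorem futuresPrice_nonneg (hf : IsPriceDensity f) : 0 ≤ futuresPrice f := by
  refine integral_nonneg fun s => ?_
  rcases le_or_gt s 0 with hs | hs
  · simp [hf.support_pos s hs]
  · exact mul_nonneg hs.le (hf.nonneg s)

/-- Put-call parity. -/
theorem callPrice_eq (hf : IsPriceDensity f) (r T K : ℝ) :
    callPrice f r T K = putPrice f r T K + Real.exp (-(r * T)) * (futuresPrice f - K) := by
  have e : ∀ s, max (s - K) 0 * f s = max (K - s) 0 * f s + (s * f s - K * f s) := fun s => by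
    rcases le_total s K with h | h
    · rw [max_eq_right (by linarith), max_eq_left (by linarith)]; ring
    · rw [max_eq_left (by linarith), max_eq_right (by linarith)]; ring
  unfold callPrice putPrice futuresPrice
  have i1 : Integrable fun s => s * f s - K * f s :=
    hf.integrable_mean.sub (hf.integrable.const_mul K)
  simp_rw [e]
  rw [integral_add (hf.integrable_hinge_mul K) i1,
    integral_sub hf.integrable_mean (hf.integrable.const_mul K), integral_const_mul,
    hf.integral_eq_one]
  ring

/-- By parity the switch from put to call at `F` amounts to subtracting a single hinge, which makes
`O₀` linear in hinge functions. -/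
theorem otmPrice_eq (hf : IsPriceDensity f) (r T K : ℝ) :
    otmPrice f r T K =
      Real.exp (-(r * T)) * ((∫ s, max (K - s) 0 * f s) - max (K - futuresPrice f) 0) := by
  unfold otmPrice
  split_ifs with h
  · rw [hf.callPrice_eq, max_eq_left (by linarith)]
    unfold putPrice
    ring
  · rw [max_eq_right (by linarith [not_lt.mp h]), sub_zero]
    rfl

end IsPriceDensity

/-! ### Quadrature error of hinges and of option prices, orders one and two -/

namespace QuadRule

variable {R : QuadRule} {α β : ℝ}

/-- There are at most `(β - α) / h` panels, so summing costs one power of `h`; the extra `B` of the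
exceptional panel `k₀` enters only once. -/
theorem abs_quadError_le_of_panelError (hαβ : α < β) {n ι : ℕ} (hn : R.Admissible n) {g : ℝ → ℝ}
    (hg : ContinuousOn g (Set.Icc α β)) {A B : ℝ} (hA : 0 ≤ A) (hB : 0 ≤ B) (k₀ : ℕ)
    (h : ∀ k < (n - 1) / R.p, |R.panelError g (R.panelStart α β n k) (mesh α β n)| ≤
      A * mesh α β n ^ (ι + 1) + if k = k₀ then B else 0) :
    |R.quadError g α β n| ≤ (β - α) * A * mesh α β n ^ ι + B := by
  rw [quadError_eq_sum_panelError hαβ hn hg]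
  have hm := mesh_pos hαβ hn.1
  have hN := hn.panels_mul_mesh (α := α) (β := β)
  have hp : (1 : ℝ) ≤ R.p := by exact_mod_cast R.p_pos
  set N := (n - 1) / R.p
  have hNm : N * mesh α β n ≤ β - α := by
    rw [← hN]
    gcongr
    nlinarith
  calc _ ≤ ∑ k ∈ Finset.range N, (A * mesh α β n ^ (ι + 1) + if k = k₀ then B else 0) :=
        (Finset.abs_sum_le_sum_abs _ _).trans
          (Finset.sum_le_sum fun k hk => h k (Finset.mem_range.mp hk))
    _ = N * mesh α β n * (A * mesh α β n ^ ι) + ∑ k ∈ Finset.range N, if k = k₀ then B else 0 := by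
        rw [Finset.sum_add_distrib, Finset.sum_const, Finset.card_range, nsmul_eq_mul]
        ring
    _ ≤ (β - α) * (A * mesh α β n ^ ι) + B := by
        gcongr
        rw [Finset.sum_ite_eq']
        split_ifs <;> simp [hB]
    _ = _ := by ring

/-- Bound for `ψ_m g` on a panel, for smooth `g`. -/
theorem HasOrder.exists_abs_panelError_psi_mul_le (hα : 0 < α) (hαβ : α < β) {ι : ℕ}
    (hι : 1 ≤ ι) (hR : R.HasOrder ι) {g : ℝ → ℝ} (hg : ContDiffOn ℝ ι g (Set.Icc α β)) :
    ∃ C : ℝ, 0 ≤ C ∧ ∀ m n k : ℕ, 0 < m → R.Admissible n → k < (n - 1) / R.p →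
      |R.panelError (fun x => psi α β m x * g x) (R.panelStart α β n k) (mesh α β n)| ≤
        C * (m : ℝ) ^ (2 + ι) * mesh α β n ^ (ι + 1) := by
  obtain ⟨C, hC0, hC⟩ := exists_abs_iteratedDerivWithin_psi_mul_le hα hαβ hg
  have hc := R.coeffBound_nonneg
  refine ⟨R.p ^ ι * R.coeffBound * C, by positivity, fun m n k hm hn hk => ?_⟩
  refine (hR.abs_panelError_le_of_contDiffOn hι hαβ (mesh_pos hαβ hn.1)
    (panel_subset hαβ hn hk) ((contDiffOn_psi hα β m ι).mul hg) (hC m hm)).trans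
    (le_of_eq (by ring))

theorem continuousOn_psi_mul_hinge (hα : 0 < α) (β : ℝ) (m : ℕ) (s : ℝ) :
    ContinuousOn (fun x => psi α β m x * max (x - s) 0) (Set.Icc α β) :=
  (continuousOn_psi hα β m).mul (by fun_prop)

/-- The constant is uniform in the kink: `s ≥ 0` bounds the hinge by `β`, and hinges are
1-Lipschitz. -/
theorem exists_lipschitz_psi_mul_hinge (hα : 0 < α) (hαβ : α < β) :
    ∃ C : ℝ, 0 ≤ C ∧ ∀ m : ℕ, 0 < m → ∀ s : ℝ, 0 ≤ s → ∀ x ∈ Set.Icc α β, ∀ y ∈ Set.Icc α β,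
      |psi α β m x * max (x - s) 0 - psi α β m y * max (y - s) 0| ≤
        C * (m : ℝ) ^ 3 * |x - y| := by
  obtain ⟨C₁, h1, hC₁⟩ := exists_abs_psi_le hα hαβ
  obtain ⟨C₂, h2, hC₂⟩ := exists_lipschitz_psi hα hαβ
  have hβ : 0 < β := hα.trans hαβ
  refine ⟨C₁ + C₂ * β, by positivity, fun m hm s hs x hx y hy => ?_⟩
  have hm1 : (1 : ℝ) ≤ m := by exact_mod_cast hm
  have e : psi α β m x * max (x - s) 0 - psi α β m y * max (y - s) 0 =
      psi α β m x * (max (x - s) 0 - max (y - s) 0) +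
        (psi α β m x - psi α β m y) * max (y - s) 0 := by ring
  have h3 : |max (x - s) 0 - max (y - s) 0| ≤ |x - y| := by
    have := abs_max_sub_max_le_abs (x - s) (y - s) 0
    rwa [sub_sub_sub_cancel_right] at this
  have h4 : |max (y - s) 0| ≤ β := by
    rw [abs_of_nonneg (le_max_right _ _)]
    exact max_le (by linarith [hy.2]) hβ.le
  have h5 : (m : ℝ) ^ 2 ≤ (m : ℝ) ^ 3 := pow_le_pow_right₀ hm1 (by norm_num)
  rw [e]
  calc _ ≤ |psi α β m x| * |max (x - s) 0 - max (y - s) 0| +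
        |psi α β m x - psi α β m y| * |max (y - s) 0| := by
        rw [← abs_mul, ← abs_mul]; exact abs_add_le _ _
    _ ≤ C₁ * (m : ℝ) ^ 3 * |x - y| + C₂ * (m : ℝ) ^ 3 * |x - y| * β := by
        gcongr
        · exact (hC₁ m hm x hx).trans (by gcongr)
        · exact hC₂ m hm x hx y hy
    _ = _ := by ring

/-- Only the panel containing its kink prevents `ψ_m (· - s)⁺` from being smooth. -/
theorem HasOrder.exists_abs_quadError_psi_mul_hinge_le (hα : 0 < α) (hαβ : α < β) {ι : ℕ}
    (hι : 1 ≤ ι) (hι2 : ι ≤ 2) (hR : R.HasOrder ι) :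
    ∃ C : ℝ, 0 ≤ C ∧ ∀ m n : ℕ, 0 < m → R.Admissible n → ∀ s : ℝ, 0 ≤ s →
      |R.quadError (fun x => psi α β m x * max (x - s) 0) α β n| ≤
        C * (m : ℝ) ^ (2 + ι) * mesh α β n ^ ι := by
  -- To the right of its kink the hinge is `x - s * 1`, so panel bounds for the two functions `x`
  -- and `1` suffice and do not depend on `s`.
  obtain ⟨C₁, h1, hC₁⟩ := hR.exists_abs_panelError_psi_mul_le hα hαβ hι
    (g := fun x => x) contDiffOn_id
  obtain ⟨C₀, h0, hC₀⟩ := hR.exists_abs_panelError_psi_mul_le hα hαβ hι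
    (g := fun _ => 1) contDiffOn_const
  obtain ⟨C₂, h2, hC₂⟩ := exists_lipschitz_psi_mul_hinge hα hαβ
  have hβ : 0 < β := hα.trans hαβ
  have hc := R.coeffBound_nonneg
  set D : ℝ := max 1 (β - α)
  have hD : 0 ≤ D := by positivity
  have hA0 : 0 ≤ C₁ + β * C₀ := by positivity
  have hl : 0 ≤ β - α := by linarith
  refine ⟨(β - α) * (C₁ + β * C₀) + R.p * R.coeffBound * C₂ * D, by positivity,
    fun m n hm hn s hs => ?_⟩
  have hm1 : (1 : ℝ) ≤ m := by exact_mod_cast hm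
  have hh := mesh_pos hαβ hn.1
  have hhl := mesh_le_length hαβ hn.1
  have hp : (0 : ℝ) < R.p := by exact_mod_cast R.p_pos
  set h := mesh α β n with h_def
  -- The panel containing the kink. For `s < α` the natural floor gives `0`, which merely treats
  -- panel `0` as exceptional.
  set k₀ := ⌊(s - α) / (R.p * h)⌋₊ with hk₀
  have hph : 0 < R.p * h := by positivity
  -- The kink panel fits the target rate: for `ι = 1` a spare `h` is at most `β - α`, for `ι = 2` a
  -- missing `m` is at least one.
  have hker : (m : ℝ) ^ 3 * h ^ 2 ≤ D * ((m : ℝ) ^ (2 + ι) * h ^ ι) := by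
    obtain rfl | rfl : ι = 1 ∨ ι = 2 := by omega
    · have : h ≤ D := hhl.trans (le_max_right _ _)
      calc (m : ℝ) ^ 3 * h ^ 2 = h * ((m : ℝ) ^ 3 * h) := by ring
        _ ≤ D * ((m : ℝ) ^ 3 * h) := by gcongr
        _ = _ := by ring
    · have h3 : (m : ℝ) ^ 3 ≤ (m : ℝ) ^ (2 + 2) := pow_le_pow_right₀ hm1 (by norm_num)
      calc (m : ℝ) ^ 3 * h ^ 2 ≤ 1 * ((m : ℝ) ^ (2 + 2) * h ^ 2) := by rw [one_mul]; gcongr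
        _ ≤ _ := by gcongr; exact le_max_left _ _
  have hcont := continuousOn_psi_mul_hinge hα β m s
  refine (abs_quadError_le_of_panelError hαβ hn hcont (ι := ι)
    (A := (C₁ + β * C₀) * (m : ℝ) ^ (2 + ι))
    (B := R.p * R.coeffBound * (C₂ * (m : ℝ) ^ 3) * h ^ 2) (by positivity) (by positivity) k₀
    fun k hk => ?_).trans ?_
  · have hsub := panel_subset hαβ hn hk
    rw [← h_def] at hsub ⊢
    set a := R.panelStart α β n k with ha
    have ha' : a = α + k * (R.p * h) := rfl
    by_cases hkk : k = k₀
    · rw [if_pos hkk]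
      have := (hR.mono hι).abs_panelError_le_of_lipschitz hh.le (L := C₂ * (m : ℝ) ^ 3)
        (by positivity) (hcont.mono hsub)
        (fun x hx y hy => hC₂ m hm s hs x (hsub hx) y (hsub hy))
      refine this.trans (le_add_of_nonneg_left (by positivity))
    · rw [if_neg hkk, add_zero]
      rcases lt_or_gt_of_ne hkk with hlt | hgt
      · have h3 : ((k + 1 : ℕ) : ℝ) ≤ (s - α) / (R.p * h) := by
          refine (Nat.cast_le.mpr hlt).trans (Nat.floor_le ?_)
          by_contra hneg
          rw [hk₀, Nat.floor_of_nonpos (not_le.mp hneg).le] at hlt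
          omega
        rw [le_div_iff₀ hph] at h3
        push_cast at h3
        rw [panelError_congr (g₂ := fun _ => 0) hh.le fun x hx => by
          have : x - s ≤ 0 := by linarith [hx.2]
          simp [max_eq_right this]]
        simp only [panelError, mul_zero, Finset.sum_const_zero, intervalIntegral.integral_zero,
          sub_zero, abs_zero]
        positivity
      · have h3 : (s - α) / (R.p * h) < k :=
          (Nat.lt_floor_add_one _).trans_le (by exact_mod_cast hgt)
        rw [div_lt_iff₀ hph] at h3
        -- A panel to the right of the kink lies in `[α, β]`, which bounds the coefficient `s` of
        -- the constant part.
        have hsβ : s ≤ β := by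
          have := (hsub ⟨le_rfl, by linarith⟩ : a ∈ Set.Icc α β).2
          linarith
        have i1 : IntervalIntegrable (fun x => psi α β m x * x) volume a (a + R.p * h) :=
          (((continuousOn_psi hα β m).mul continuousOn_id).mono hsub).intervalIntegrable_of_Icc
            (by linarith)
        have i2 : IntervalIntegrable (fun x => s * (psi α β m x * 1)) volume a (a + R.p * h) :=
          ((continuousOn_const.mul ((continuousOn_psi hα β m).mul continuousOn_const)).mono
            hsub).intervalIntegrable_of_Icc (by linarith)
        rw [panelError_congr (g₂ := fun x => psi α β m x * x - s * (psi α β m x * 1)) hh.le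
          fun x hx => by
            have : 0 ≤ x - s := by linarith [hx.1]
            simp only [max_eq_left this]
            ring, panelError_sub i1 i2, panelError_const_mul]
        have e1 := hC₁ m n k hm hn hk
        have e2 := hC₀ m n k hm hn hk
        rw [← h_def, ← ha] at e1 e2
        refine (abs_sub _ _).trans ?_
        rw [abs_mul, abs_of_nonneg hs]
        calc _ ≤ C₁ * (m : ℝ) ^ (2 + ι) * h ^ (ι + 1) +
              β * (C₀ * (m : ℝ) ^ (2 + ι) * h ^ (ι + 1)) := by gcongr
          _ = _ := by ring
  · rw [← h_def]
    calc _ = (β - α) * (C₁ + β * C₀) * (m : ℝ) ^ (2 + ι) * h ^ ι +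
          R.p * R.coeffBound * C₂ * ((m : ℝ) ^ 3 * h ^ 2) := by ring
      _ ≤ (β - α) * (C₁ + β * C₀) * (m : ℝ) ^ (2 + ι) * h ^ ι +
          R.p * R.coeffBound * C₂ * (D * ((m : ℝ) ^ (2 + ι) * h ^ ι)) := by gcongr
      _ = _ := by ring

theorem integrable_psi_mul_hinge_mul {f : ℝ → ℝ} (hf : IsPriceDensity f) (hα : 0 < α)
    (hαβ : α < β) (m : ℕ) :
    Integrable (Function.uncurry fun K s => psi α β m K * (max (K - s) 0 * f s))
      ((volume.restrict (Set.uIoc α β)).prod volume) := by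
  rw [Set.uIoc_of_le hαβ.le]
  have hψ : IntegrableOn (psi α β m) (Set.Ioc α β) :=
    ((continuousOn_psi hα β m).integrableOn_Icc).mono_set Set.Ioc_subset_Icc_self
  have hβ : 0 < β := hα.trans hαβ
  have hb : Integrable (fun q : ℝ × ℝ => |psi α β m q.1| * (β * f q.2))
      ((volume.restrict (Set.Ioc α β)).prod volume) :=
    Integrable.mul_prod hψ.norm (hf.integrable.const_mul β)
  have hfm := hf.measurable
  refine hb.mono' ?_ ?_
  · have h1 : AEStronglyMeasurable (fun q : ℝ × ℝ => psi α β m q.1)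
        ((volume.restrict (Set.Ioc α β)).prod volume) := hψ.1.comp_fst
    have h2 : Measurable (fun q : ℝ × ℝ => max (q.1 - q.2) 0 * f q.2) := by fun_prop
    exact h1.mul h2.aestronglyMeasurable
  · have : ∀ᵐ q : ℝ × ℝ ∂((volume.restrict (Set.Ioc α β)).prod volume), q.1 ∈ Set.Ioc α β :=
      Measure.quasiMeasurePreserving_fst.ae (ae_restrict_mem measurableSet_Ioc)
    filter_upwards [this] with q hq
    simp only [Function.uncurry, norm_mul, Real.norm_eq_abs]
    have h0 := hf.nonneg q.2
    rw [abs_of_nonneg h0]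
    gcongr ?_ * ?_
    rcases le_or_gt q.2 0 with hs | hs
    · simp [hf.support_pos q.2 hs]
    · rw [abs_of_nonneg (le_max_right _ _)]
      gcongr
      exact max_le (by linarith [hq.2]) hβ.le

/-- The discretization error is a mixture of the discretization errors of hinge functions. -/
theorem quadError_psi_mul_otmPrice {f : ℝ → ℝ} (hf : IsPriceDensity f) (r T : ℝ) (hα : 0 < α)
    (hαβ : α < β) (m n : ℕ) :
    R.quadError (fun x => psi α β m x * otmPrice f r T x) α β n =
      Real.exp (-(r * T)) *
        ((∫ s, f s * R.quadError (fun x => psi α β m x * max (x - s) 0) α β n) -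
          R.quadError (fun x => psi α β m x * max (x - futuresPrice f) 0) α β n) := by
  have hint := integrable_psi_mul_hinge_mul hf hα hαβ m
  have hswap := intervalIntegral_integral_swap hint
  have hci (s : ℝ) : IntervalIntegrable (fun x => psi α β m x * max (x - s) 0) volume α β :=
    (continuousOn_psi_mul_hinge hα β m s).intervalIntegrable_of_Icc hαβ.le
  have hK : IntervalIntegrable (fun K => ∫ s, psi α β m K * (max (K - s) 0 * f s)) volume α β := by
    rw [intervalIntegrable_iff]
    exact hint.integral_prod_left
  have hs : Integrable fun s => ∫ K in α..β, psi α β m K * (max (K - s) 0 * f s) := by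
    simp_rw [intervalIntegral.integral_of_le hαβ.le]
    rw [Set.uIoc_of_le hαβ.le] at hint
    exact hint.integral_prod_right
  have hs' (s : ℝ) : ∫ K in α..β, psi α β m K * (max (K - s) 0 * f s) =
      f s * ∫ K in α..β, psi α β m K * max (K - s) 0 := by
    rw [← intervalIntegral.integral_const_mul]
    congr 1 with K
    ring
  have e1 : ∫ x in α..β, psi α β m x * otmPrice f r T x = Real.exp (-(r * T)) *
      ((∫ s, f s * ∫ K in α..β, psi α β m K * max (K - s) 0) -
        ∫ K in α..β, psi α β m K * max (K - futuresPrice f) 0) := by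
    simp_rw [← hs']
    rw [← hswap, ← intervalIntegral.integral_sub hK (hci _), ← intervalIntegral.integral_const_mul]
    congr 1 with K
    rw [hf.otmPrice_eq, integral_const_mul]
    ring
  have e2 : ∫ s, f s * R.quadError (fun x => psi α β m x * max (x - s) 0) α β n =
      ∑ i ∈ Finset.Icc 1 n, R.weight n i * (psi α β m (strike α β n i) *
        ∫ s, max (strike α β n i - s) 0 * f s) * mesh α β n -
      ∫ s, f s * ∫ K in α..β, psi α β m K * max (K - s) 0 := by
    simp_rw [hs'] at hs
    have hsum (i : ℕ) : Integrable fun s => R.weight n i * psi α β m (strike α β n i) *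
        mesh α β n * (max (strike α β n i - s) 0 * f s) :=
      (hf.integrable_hinge_mul _).const_mul _
    have e (s : ℝ) : f s * R.quadError (fun x => psi α β m x * max (x - s) 0) α β n =
        ∑ i ∈ Finset.Icc 1 n, R.weight n i * psi α β m (strike α β n i) *
          mesh α β n * (max (strike α β n i - s) 0 * f s) -
        f s * ∫ K in α..β, psi α β m K * max (K - s) 0 := by
      unfold quadError
      rw [mul_sub, Finset.mul_sum]
      congr 1
      exact Finset.sum_congr rfl fun i _ => by ring
    simp_rw [e]
    rw [integral_sub (integrable_finsetSum _ fun i _ => hsum i) hs,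
      integral_finsetSum _ fun i _ => hsum i]
    congr 1
    refine Finset.sum_congr rfl fun i _ => ?_
    rw [integral_const_mul]
    ring
  rw [e2]
  unfold quadError
  rw [e1]
  simp_rw [hf.otmPrice_eq]
  have e3 : ∑ i ∈ Finset.Icc 1 n, R.weight n i * (psi α β m (strike α β n i) *
      (Real.exp (-(r * T)) * ((∫ s, max (strike α β n i - s) 0 * f s) -
        max (strike α β n i - futuresPrice f) 0))) * mesh α β n =
      Real.exp (-(r * T)) * (∑ i ∈ Finset.Icc 1 n, R.weight n i * (psi α β m (strike α β n i) *
        ∫ s, max (strike α β n i - s) 0 * f s) * mesh α β n -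
      ∑ i ∈ Finset.Icc 1 n, R.weight n i * (psi α β m (strike α β n i) *
        max (strike α β n i - futuresPrice f) 0) * mesh α β n) := by
    rw [← Finset.sum_sub_distrib, Finset.mul_sum]
    exact Finset.sum_congr rfl fun i _ => by ring
  rw [e3]
  ring

/-- The hinge bound is uniform in `s ≥ 0`, so it survives averaging against `f`; the second `C` is
for the hinge at `F`. -/
theorem HasOrder.exists_abs_quadError_le_of_le_two {f : ℝ → ℝ} (hf : IsPriceDensity f) (r T : ℝ)
    (hα : 0 < α) (hαβ : α < β) {ι : ℕ} (hι : 1 ≤ ι) (hι2 : ι ≤ 2) (hR : R.HasOrder ι) :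
    ∃ C : ℝ, 0 ≤ C ∧ ∀ m n : ℕ, 0 < m → R.Admissible n →
      |R.quadError (fun x => psi α β m x * otmPrice f r T x) α β n| ≤
        C * (m : ℝ) ^ (2 + ι) * mesh α β n ^ ι := by
  obtain ⟨C, h0, hC⟩ := hR.exists_abs_quadError_psi_mul_hinge_le hα hαβ hι hι2
  refine ⟨Real.exp (-(r * T)) * (C + C), by positivity, fun m n hm hn => ?_⟩
  rw [quadError_psi_mul_otmPrice hf r T hα hαβ, abs_mul, abs_of_pos (Real.exp_pos _)]
  set B := C * (m : ℝ) ^ (2 + ι) * mesh α β n ^ ι with hB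
  have h1 : |∫ s, f s * R.quadError (fun x => psi α β m x * max (x - s) 0) α β n| ≤ B := by
    have := norm_integral_le_of_norm_le (hf.integrable.mul_const B)
      (f := fun s => f s * R.quadError (fun x => psi α β m x * max (x - s) 0) α β n)
      (ae_of_all _ fun s => by
        rw [norm_mul, Real.norm_eq_abs, Real.norm_eq_abs, abs_of_nonneg (hf.nonneg s)]
        rcases le_or_gt s 0 with hs | hs
        · simp [hf.support_pos s hs]
        · exact mul_le_mul_of_nonneg_left (hC m n hm hn s hs.le) (hf.nonneg s))
    rwa [integral_mul_const, hf.integral_eq_one, one_mul] at this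
  have h2 := hC m n hm hn _ hf.futuresPrice_nonneg
  calc _ ≤ Real.exp (-(r * T)) * (B + B) := by
        gcongr
        exact (abs_sub _ _).trans (add_le_add h1 h2)
    _ = _ := by rw [hB]; ring

end QuadRule

/-! ### Smoothness of option prices in the strike -/

theorem contDiffOn_succ_of_hasDerivWithinAt {S : Set ℝ} (hS : UniqueDiffOn ℝ S) {g g' : ℝ → ℝ}
    {n : ℕ} (h : ∀ x ∈ S, HasDerivWithinAt g (g' x) S x) (hg' : ContDiffOn ℝ n g' S) :
    ContDiffOn ℝ (n + 1 : ℕ) g S := by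
  push_cast
  rw [contDiffOn_succ_iff_derivWithin hS]
  refine ⟨fun x hx => (h x hx).differentiableWithinAt, fun hn => ?_,
    hg'.congr fun x hx => (h x hx).derivWithin (hS x hx)⟩
  exact absurd hn (by simp)

/-- Extending `g` by constants outside the interval makes it continuous, so the fundamental theorem
also covers the end points. -/
theorem hasDerivWithinAt_integral_Icc {α β : ℝ} {g : ℝ → ℝ} (hg : ContinuousOn g (Set.Icc α β))
    {x : ℝ} (hx : x ∈ Set.Icc α β) :
    HasDerivWithinAt (fun K => ∫ s in α..K, g s) (g x) (Set.Icc α β) x := by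
  have hαβ : α ≤ β := hx.1.trans hx.2
  set e : ℝ → ℝ := Set.IccExtend hαβ ((Set.Icc α β).domRestrict g) with he
  have hec : Continuous e := (continuousOn_iff_continuous_domRestrict.mp hg).Icc_extend'
  have heq : ∀ y ∈ Set.Icc α β, e y = g y := fun y hy => by
    rw [he, Set.IccExtend_of_mem _ _ hy]; rfl
  have h1 := (hec.integral_hasStrictDerivAt α x).hasDerivAt.hasDerivWithinAt (s := Set.Icc α β)
  rw [heq x hx] at h1
  refine h1.congr (fun K hK => ?_) ?_ <;>
  · refine intervalIntegral.integral_congr fun s hs => (heq s ?_).symm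
    rw [Set.uIcc_of_le (by first | exact hK.1 | exact hx.1)] at hs
    exact ⟨hs.1, hs.2.trans (by first | exact hK.2 | exact hx.2)⟩

namespace IsPriceDensity

variable {f : ℝ → ℝ}

/-- Cutting at `α` isolates a part affine in `K`, so smoothness in the strike requires regularity of
`f` on `[α, β]` only. -/
theorem integral_hinge_mul_eq (hf : IsPriceDensity f) (α K : ℝ) :
    ∫ s, max (K - s) 0 * f s =
      (K * (∫ s in Set.Iic α, f s) - ∫ s in Set.Iic α, s * f s) +
        (K * (∫ s in α..K, f s) - ∫ s in α..K, s * f s) := by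
  have h1 : ∫ s, max (K - s) 0 * f s = ∫ s in Set.Iic K, (K * f s - s * f s) := by
    rw [← integral_indicator measurableSet_Iic]
    congr 1 with s
    by_cases hs : s ≤ K
    · rw [Set.indicator_of_mem (by exact hs), max_eq_left (by linarith)]
      ring
    · rw [Set.indicator_of_notMem (by exact hs), max_eq_right (by linarith), zero_mul]
  have i1 := hf.integrable
  have i2 := hf.integrable_mean
  rw [h1, integral_sub (i1.const_mul K).integrableOn i2.integrableOn, integral_const_mul,
    ← intervalIntegral.integral_Iic_sub_Iic i1.integrableOn i1.integrableOn,
    ← intervalIntegral.integral_Iic_sub_Iic i2.integrableOn i2.integrableOn]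
  ring

theorem contDiffOn_putPrice (hf : IsPriceDensity f) (r T : ℝ) {α β : ℝ} (hαβ : α < β) {n : ℕ}
    (hfn : ContDiffOn ℝ n f (Set.Icc α β)) :
    ContDiffOn ℝ (n + 2 : ℕ) (putPrice f r T) (Set.Icc α β) := by
  have hS := uniqueDiffOn_Icc hαβ
  have hΦ (x : ℝ) (hx : x ∈ Set.Icc α β) := hasDerivWithinAt_integral_Icc hfn.continuousOn hx
  have hΨ (x : ℝ) (hx : x ∈ Set.Icc α β) :=
    hasDerivWithinAt_integral_Icc (continuousOn_id.mul hfn.continuousOn) hx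
  have h1 : ContDiffOn ℝ (n + 1 : ℕ) (fun K => ∫ s in α..K, f s) (Set.Icc α β) :=
    contDiffOn_succ_of_hasDerivWithinAt hS hΦ hfn
  have h2 : ContDiffOn ℝ (n + 1 + 1 : ℕ) (fun K => ∫ s, max (K - s) 0 * f s) (Set.Icc α β) := by
    refine contDiffOn_succ_of_hasDerivWithinAt hS
      -- The derivative is the distribution function: the boundary terms `x f(x)` cancel. Its own
      -- derivative is `f`, whence the gain of two orders.
      (g' := fun K => (∫ s in Set.Iic α, f s) + ∫ s in α..K, f s) (fun x hx => ?_)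
      (contDiffOn_const.add h1)
    have h3 := (((hasDerivWithinAt_id x (Set.Icc α β)).mul_const (∫ s in Set.Iic α, f s)).sub_const
      (∫ s in Set.Iic α, s * f s)).add
      (((hasDerivWithinAt_id x (Set.Icc α β)).mul (hΦ x hx)).sub (hΨ x hx))
    refine (h3.congr (fun K _ => hf.integral_hinge_mul_eq α K)
      (hf.integral_hinge_mul_eq α x)).congr_deriv ?_
    simp
  exact contDiffOn_const.mul h2

theorem contDiffOn_callPrice (hf : IsPriceDensity f) (r T : ℝ) {α β : ℝ} (hαβ : α < β) {n : ℕ}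
    (hfn : ContDiffOn ℝ n f (Set.Icc α β)) :
    ContDiffOn ℝ (n + 2 : ℕ) (callPrice f r T) (Set.Icc α β) := by
  have h : ContDiffOn ℝ (n + 2 : ℕ) (fun K => Real.exp (-(r * T)) * (futuresPrice f - K))
    (Set.Icc α β) := by fun_prop
  exact ((hf.contDiffOn_putPrice r T hαβ hfn).add h).congr fun K _ => hf.callPrice_eq r T K

theorem otmPrice_of_le (hK : K ≤ futuresPrice f) (r T : ℝ) : otmPrice f r T K = putPrice f r T K :=
  if_neg (not_lt.mpr hK)

theorem otmPrice_of_ge (hf : IsPriceDensity f) {K : ℝ} (hK : futuresPrice f ≤ K) (r T : ℝ) :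
    otmPrice f r T K = callPrice f r T K := by
  rcases hK.lt_or_eq with h | h
  · exact if_pos h
  · rw [otmPrice_of_le h.ge, hf.callPrice_eq, h, sub_self, mul_zero, add_zero]

theorem continuousOn_otmPrice (hf : IsPriceDensity f) (r T : ℝ) {α β : ℝ} (hαβ : α < β)
    (hfc : ContinuousOn f (Set.Icc α β)) : ContinuousOn (otmPrice f r T) (Set.Icc α β) := by
  have h1 := (hf.contDiffOn_putPrice r T hαβ (n := 0) (contDiffOn_zero.mpr hfc)).continuousOn
  have h2 : ContinuousOn (fun K => Real.exp (-(r * T)) * max (K - futuresPrice f) 0)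
    (Set.Icc α β) := by fun_prop
  refine (h1.sub h2).congr fun K _ => ?_
  rw [hf.otmPrice_eq, Pi.sub_apply]
  unfold putPrice
  ring

end IsPriceDensity

/-! ### Quadrature error for orders above two -/

namespace QuadRule

variable {R : QuadRule} {α β : ℝ}

theorem HasOrder.exists_abs_quadError_le_of_contDiffOn {f : ℝ → ℝ} (hf : IsPriceDensity f)
    (r T : ℝ) (hα : 0 < α) (hαβ : α < β) {ι : ℕ} (hι : 2 < ι) (hR : R.HasOrder ι)
    (hfn : ContDiffOn ℝ (ι - 2 : ℕ) f (Set.Icc α β)) :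
    ∃ C : ℝ, 0 ≤ C ∧ ∀ m n : ℕ, 0 < m → R.Admissible n →
      (futuresPrice f ∈ Set.Ioo α β → ∃ k : ℕ, futuresPrice f = strike α β n (k * R.p + 1)) →
      |R.quadError (fun x => psi α β m x * otmPrice f r T x) α β n| ≤
        C * (m : ℝ) ^ (2 + ι) * mesh α β n ^ ι := by
  have hput := hf.contDiffOn_putPrice r T hαβ hfn
  have hcall := hf.contDiffOn_callPrice r T hαβ hfn
  rw [Nat.sub_add_cancel hι.le] at hput hcall
  obtain ⟨C₁, h1, hC₁⟩ := hR.exists_abs_panelError_psi_mul_le hα hαβ (by omega) hput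
  obtain ⟨C₂, h2, hC₂⟩ := hR.exists_abs_panelError_psi_mul_le hα hαβ (by omega) hcall
  have hl : 0 ≤ β - α := by linarith
  refine ⟨(β - α) * (C₁ + C₂), by positivity, fun m n hm hn hF => ?_⟩
  have hh := mesh_pos hαβ hn.1
  have hp : (0 : ℝ) < R.p := by exact_mod_cast R.p_pos
  have hph : 0 < R.p * mesh α β n := by positivity
  have hcont : ContinuousOn (fun x => psi α β m x * otmPrice f r T x) (Set.Icc α β) :=
    (continuousOn_psi hα β m).mul (hf.continuousOn_otmPrice r T hαβ hfn.continuousOn)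
  -- Every panel lies on one side of `F`, so `O₀` is there one of two functions smooth on all of
  -- `[α, β]`.
  have hside : ∀ k < (n - 1) / R.p, R.panelStart α β n k + R.p * mesh α β n ≤ futuresPrice f ∨
      futuresPrice f ≤ R.panelStart α β n k := by
    intro k hk
    have hsub := panel_subset hαβ hn hk
    by_cases hFm : futuresPrice f ∈ Set.Ioo α β
    · obtain ⟨k₁, hk₁⟩ := hF hFm
      rw [← add_zero (k₁ * R.p), strike_panel, Nat.cast_zero, zero_mul, add_zero] at hk₁
      rcases lt_or_ge k k₁ with h | h
      · left
        have : ((k + 1 : ℕ) : ℝ) ≤ k₁ := by exact_mod_cast h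
        rw [← panelStart_succ, hk₁]
        unfold panelStart
        gcongr
      · right
        rw [hk₁]
        unfold panelStart
        gcongr
    · rw [Set.mem_Ioo, not_and_or, not_lt, not_lt] at hFm
      rcases hFm with h | h
      · exact Or.inr (h.trans (hsub ⟨le_rfl, by linarith⟩).1)
      · exact Or.inl ((hsub ⟨by linarith, le_rfl⟩).2.trans h)
  refine (abs_quadError_le_of_panelError hαβ hn hcont (ι := ι)
    (A := (C₁ + C₂) * (m : ℝ) ^ (2 + ι)) (B := 0) (by positivity) le_rfl 0 fun k hk => ?_).trans
    (le_of_eq (by ring))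
  rw [ite_self, add_zero]
  rcases hside k hk with h | h
  · rw [panelError_congr (g₂ := fun x => psi α β m x * putPrice f r T x) hh.le fun x hx => by
      simp only [IsPriceDensity.otmPrice_of_le (hx.2.trans h)]]
    refine (hC₁ m n k hm hn hk).trans ?_
    gcongr
    linarith
  · rw [panelError_congr (g₂ := fun x => psi α β m x * callPrice f r T x) hh.le fun x hx => by
      simp only [hf.otmPrice_of_ge (h.trans hx.1)]]
    refine (hC₂ m n k hm hn hk).trans ?_
    gcongr
    linarith

end QuadRule

/-! ### Weights of a composite rule and the variance of the estimator -/

theorem tendsto_mesh {α β : ℝ} (hαβ : α < β) : Tendsto (mesh α β) atTop (𝓝 0) := by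
  have h1 : Tendsto (fun n : ℕ => 2 * (β - α) / (n : ℝ)) atTop (𝓝 0) :=
    tendsto_const_div_atTop_nhds_zero_nat _
  refine squeeze_zero' ?_ ?_ h1
  · filter_upwards [eventually_ge_atTop 2] with n hn using (mesh_pos hαβ hn).le
  · filter_upwards [eventually_ge_atTop 2] with n hn using mesh_le hαβ hn

namespace QuadRule

variable {R : QuadRule}

/-- For each position `j` at most one panel has node `i` in that position, so the bound does not
depend on `n`. -/
theorem abs_weight_le (R : QuadRule) (n i : ℕ) : |R.weight n i| ≤ R.coeffBound := by
  have h1 : |R.weight n i| ≤ ∑ j ∈ Finset.range (R.p + 1), |R.c j| := by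
    unfold weight
    rw [Finset.sum_comm]
    refine (Finset.abs_sum_le_sum_abs _ _).trans (Finset.sum_le_sum fun j _ => ?_)
    by_cases h : ∃ k ∈ Finset.range ((n - 1) / R.p), k * R.p + j + 1 = i
    · obtain ⟨k, hk, rfl⟩ := h
      rw [Finset.sum_eq_single_of_mem k hk fun k' _ hne => if_neg fun he => hne ?_]
      · simp
      · exact Nat.eq_of_mul_eq_mul_right R.p_pos (by omega)
    · rw [Finset.sum_eq_zero fun k hk => if_neg fun he => h ⟨k, hk, he⟩, abs_zero]
      exact abs_nonneg _
  unfold coeffBound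
  have : (0 : ℝ) ≤ R.p := Nat.cast_nonneg _
  linarith

theorem eq_of_mul_add_eq {p k k' j j' : ℕ} (hj : j < p) (hj' : j' < p)
    (h : k' * p + j' = k * p + j) : k' = k ∧ j' = j := by
  have hp : 0 < p := by omega
  have e (k j : ℕ) (hj : j < p) : (k * p + j) / p = k := by
    rw [add_comm, Nat.add_mul_div_right _ _ hp, Nat.div_eq_of_lt hj, zero_add]
  have h1 : k' = k := by rw [← e k' j' hj', h, e k j hj]
  subst h1
  exact ⟨rfl, by omega⟩

/-- The weight of a node that is not in the first panel, nor the last node. -/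
theorem weight_of_lt {n k j : ℕ} (hj : j < R.p) (hk1 : 1 ≤ k) (hk : k < (n - 1) / R.p) :
    R.weight n (k * R.p + j + 1) = R.c j + if j = 0 then R.c R.p else 0 := by
  unfold weight
  simp_rw [Finset.sum_range_succ, Finset.sum_add_distrib, Nat.add_right_cancel_iff]
  congr 1
  · rw [Finset.sum_eq_single_of_mem k (Finset.mem_range.mpr hk) fun k' _ hne =>
      Finset.sum_eq_zero fun j' hj' => if_neg fun he =>
        hne (eq_of_mul_add_eq hj (Finset.mem_range.mp hj') he).1,
      Finset.sum_eq_single_of_mem j (Finset.mem_range.mpr hj) fun j' hj' hne => if_neg fun he =>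
        hne (eq_of_mul_add_eq hj (Finset.mem_range.mp hj') he).2]
    simp
  · have e (k' : ℕ) : k' * R.p + R.p = (k' + 1) * R.p + 0 := by ring
    simp_rw [e]
    split_ifs with h0
    · subst h0
      rw [Finset.sum_eq_single_of_mem (k - 1) (Finset.mem_range.mpr (by omega)) fun k' _ hne =>
        if_neg fun he => hne (by have := (eq_of_mul_add_eq hj hj he).1; omega),
        if_pos (by rw [Nat.sub_add_cancel hk1])]
    · exact Finset.sum_eq_zero fun k' _ => if_neg fun he =>
        h0 (eq_of_mul_add_eq hj R.p_pos he).2.symm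

/-- Some node position in a panel carries a non-zero weight. -/
theorem HasOrder.exists_weight_ne_zero (hR : R.HasOrder 1) :
    ∃ j < R.p, ∃ d : ℝ, d ≠ 0 ∧ ∀ n k : ℕ, 1 ≤ k → k < (n - 1) / R.p →
      R.weight n (k * R.p + j + 1) = d := by
  by_contra hne
  -- If all interior weights vanished, the coefficients would sum to zero, whereas exactness on
  -- constants makes the sum `p > 0`.
  have h0 : ∀ j ∈ Finset.range R.p, (R.c j + if j = 0 then R.c R.p else 0) = 0 := fun j hj => by
    by_contra hd
    exact hne ⟨j, Finset.mem_range.mp hj, _, hd, fun n k hk1 hk =>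
      weight_of_lt (Finset.mem_range.mp hj) hk1 hk⟩
  have h1 := Finset.sum_eq_zero h0
  rw [Finset.sum_add_distrib, Finset.sum_ite_eq', if_pos (Finset.mem_range.mpr R.p_pos),
    ← Finset.sum_range_succ] at h1
  have h2 := hR 0 one_pos
  simp only [pow_zero, mul_one, h1, intervalIntegral.integral_const, sub_zero, smul_eq_mul] at h2
  exact R.p_pos.ne (by exact_mod_cast h2)

/-- Keeping only the nodes in a position of weight `d ≠ 0` leaves a sum over a grid of spacing `p
h`, so the lower bound tends to `(d² / p) ∫ g`. -/
theorem HasOrder.exists_le_mesh_mul_sum_weight_sq (hR : R.HasOrder 1) {α β : ℝ} (hαβ : α < β)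
    {g : ℝ → ℝ} {L : ℝ} (hL : 0 ≤ L) (hg0 : ∀ x ∈ Set.Icc α β, 0 ≤ g x)
    (hg : ContinuousOn g (Set.Icc α β)) (hI : 0 < ∫ x in α..β, g x)
    (hlip : ∀ x ∈ Set.Icc α β, ∀ y ∈ Set.Icc α β, |g x - g y| ≤ L * |x - y|) :
    ∃ c : ℝ, 0 < c ∧ ∀ᶠ n in atTop ⊓ 𝓟 {n | R.Admissible n},
      c ≤ mesh α β n * ∑ i ∈ Finset.Icc 1 n, R.weight n i ^ 2 * g (strike α β n i) := by
  obtain ⟨j, hj, d, hd, hw⟩ := hR.exists_weight_ne_zero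
  have hp : (0 : ℝ) < R.p := by exact_mod_cast R.p_pos
  -- All mass `p` sits at position `j`: this rule is exact on constants, hence its error for
  -- Lipschitz `g` is `O(h)`.
  set Q : QuadRule := ⟨R.p, R.p_pos, fun i => if i = j then R.p else 0⟩ with hQ
  have hQ1 : Q.HasOrder 1 := by
    intro e he
    obtain rfl : e = 0 := by omega
    have : j < R.p + 1 := by omega
    simp [hQ, this]
  obtain ⟨G, hG⟩ := isCompact_Icc.exists_bound_of_continuousOn hg
  set I := ∫ x in α..β, g x
  set D := (β - α) * (Q.p * Q.coeffBound * L) with hD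
  have hl : 0 < β - α := by linarith
  have hlim : Tendsto (fun n => d ^ 2 / R.p * (I - D * mesh α β n - R.p * G * mesh α β n))
      (atTop ⊓ 𝓟 {n | R.Admissible n}) (𝓝 (d ^ 2 / R.p * I)) := by
    have hm := (tendsto_mesh hαβ).mono_left
      (inf_le_left : atTop ⊓ 𝓟 {n | R.Admissible n} ≤ atTop)
    have := ((hm.const_mul D).const_sub I).sub (hm.const_mul (R.p * G))
    simpa using this.const_mul (d ^ 2 / R.p)
  have hpos : 0 < d ^ 2 / R.p * I := by positivity
  refine ⟨d ^ 2 / R.p * I / 2, by positivity, ?_⟩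
  filter_upwards [hlim.eventually_const_lt (half_lt_self hpos),
    mem_inf_of_right (mem_principal_self _)] with n hn1 hn
  refine hn1.le.trans ?_
  have hnQ : Q.Admissible n := hn
  have hh := mesh_pos hαβ hn.1
  set h := mesh α β n with h_def
  set N := (n - 1) / R.p
  have hmem : ∀ k < N, k * R.p + j + 1 ∈ Finset.Icc 1 n := by
    intro k hk
    have h1 := hn.panels_mul
    have h4 : (k + 1) * R.p ≤ (n - 1) / R.p * R.p := Nat.mul_le_mul_right _ hk
    have h5 := hn.1
    rw [add_mul] at h4
    exact Finset.mem_Icc.mpr ⟨by omega, by omega⟩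
  have hq : I - D * h ≤ R.p * h * ∑ k ∈ Finset.range N, g (strike α β n (k * R.p + j + 1)) := by
    have h1 : |Q.quadError g α β n| ≤ D * h := by
      refine (abs_quadError_le_of_panelError hαβ hnQ hg (ι := 1)
        (A := Q.p * Q.coeffBound * L) (B := 0)
        (by have := Q.coeffBound_nonneg; positivity) le_rfl 0 fun k hk => ?_).trans
        (le_of_eq (by rw [hD]; ring))
      rw [ite_self, add_zero]
      have hsub := panel_subset hαβ hnQ hk
      exact hQ1.abs_panelError_le_of_lipschitz hh.le hL (hg.mono hsub)
        fun x hx y hy => hlip x (hsub hx) y (hsub hy)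
    have h2 : ∑ i ∈ Finset.Icc 1 n, Q.weight n i * g (strike α β n i) * h =
        R.p * h * ∑ k ∈ Finset.range N, g (strike α β n (k * R.p + j + 1)) := by
      rw [← Finset.sum_mul, sum_weight_mul hnQ fun i => g (strike α β n i), Finset.sum_mul,
        Finset.mul_sum]
      refine Finset.sum_congr rfl fun k _ => ?_
      simp only [hQ, ite_mul, zero_mul]
      rw [Finset.sum_ite_eq', if_pos (Finset.mem_range.mpr (by omega))]
      ring
    unfold quadError at h1
    rw [← h_def, h2] at h1
    have := (abs_le.mp h1).1
    linarith
  -- The weight is known to be `d` only from panel `1` on; dropping panel `0` costs at most `G`,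
  -- negligible after multiplication by `h`.
  have hsum : d ^ 2 * ((∑ k ∈ Finset.range N, g (strike α β n (k * R.p + j + 1))) - G) ≤
      ∑ i ∈ Finset.Icc 1 n, R.weight n i ^ 2 * g (strike α β n i) := by
    have hinj : Set.InjOn (fun k => k * R.p + j + 1) (Finset.Ico 1 N : Finset ℕ) :=
      fun k _ k' _ he => Nat.eq_of_mul_eq_mul_right R.p_pos (by simp only at he; omega)
    have hsub : (Finset.Ico 1 N).image (fun k => k * R.p + j + 1) ⊆ Finset.Icc 1 n := by
      intro i hi
      obtain ⟨k, hk, rfl⟩ := Finset.mem_image.mp hi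
      exact hmem k (Finset.mem_Ico.mp hk).2
    refine le_trans ?_ (Finset.sum_le_sum_of_subset_of_nonneg hsub fun i hi _ =>
      mul_nonneg (sq_nonneg _) (hg0 _ (strike_mem_Icc hαβ hn.1 hi)))
    rw [Finset.sum_image hinj]
    have hd2 : ∀ k ∈ Finset.Ico 1 N, R.weight n (k * R.p + j + 1) ^ 2 *
        g (strike α β n (k * R.p + j + 1)) = d ^ 2 * g (strike α β n (k * R.p + j + 1)) :=
      fun k hk => by rw [hw n k (Finset.mem_Ico.mp hk).1 (Finset.mem_Ico.mp hk).2]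
    rw [Finset.sum_congr rfl hd2, ← Finset.mul_sum]
    gcongr
    have hN : 0 < N := Nat.div_pos (Nat.le_of_dvd (by have := hn.1; omega) hn.2) R.p_pos
    rw [Finset.range_eq_Ico, Finset.sum_eq_sum_Ico_succ_bot hN]
    have := (le_abs_self _).trans (hG _ (strike_mem_Icc hαβ hn.1 (hmem 0 hN)))
    rw [zero_add]
    linarith
  calc d ^ 2 / R.p * (I - D * h - R.p * G * h)
      ≤ d ^ 2 / R.p * (R.p * h * ∑ k ∈ Finset.range N, g (strike α β n (k * R.p + j + 1)) -
          R.p * G * h) := by gcongr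
    _ = h * (d ^ 2 * ((∑ k ∈ Finset.range N, g (strike α β n (k * R.p + j + 1))) - G)) := by
        field_simp
    _ ≤ _ := by gcongr

end QuadRule

theorem integral_sq_psi_pos {α β : ℝ} (hα : 0 < α) (hαβ : α < β) {m : ℕ} (hm : 0 < m) :
    0 < ∫ x in α..β, psi α β m x ^ 2 := by
  refine intervalIntegral.integral_pos hαβ ((continuousOn_psi hα β m).pow 2)
    (fun x _ => sq_nonneg _) ⟨α, ⟨le_rfl, hαβ.le⟩, ?_⟩
  have := psi_left_ne_zero hα hαβ hm
  positivity

/-- The variance of the estimator is at least of the order of the mesh. -/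
theorem QuadRule.HasOrder.exists_le_sum_weight_sq_psi_sq {R : QuadRule} (hR : R.HasOrder 1)
    {α β : ℝ} (hα : 0 < α) (hαβ : α < β) {m : ℕ} (hm : 0 < m) :
    ∃ c : ℝ, 0 < c ∧ ∀ᶠ n in atTop ⊓ 𝓟 {n | R.Admissible n},
      c ≤ mesh α β n *
        ∑ i ∈ Finset.Icc 1 n, R.weight n i ^ 2 * psi α β m (strike α β n i) ^ 2 := by
  obtain ⟨C₁, h1, hC₁⟩ := exists_abs_psi_le hα hαβ
  obtain ⟨C₂, h2, hC₂⟩ := exists_lipschitz_psi hα hαβ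
  refine hR.exists_le_mesh_mul_sum_weight_sq hαβ (g := fun x => psi α β m x ^ 2)
    (L := 2 * (C₁ * (m : ℝ) ^ 2) * (C₂ * (m : ℝ) ^ 3)) (by positivity) (fun x _ => sq_nonneg _)
    ((continuousOn_psi hα β m).pow 2) (integral_sq_psi_pos hα hαβ hm) fun x hx y hy => ?_
  rw [sq_sub_sq, abs_mul, mul_assoc]
  gcongr
  · refine (abs_add_le _ _).trans ?_
    have := hC₁ m hm x hx
    have := hC₁ m hm y hy
    linarith
  · exact hC₂ m hm x hx y hy

/-! ### Bias, discretization error and asymptotic normality -/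

theorem discretizationError_eq_quadError (R : QuadRule) (f : ℝ → ℝ) (r T α β : ℝ) (m n : ℕ) :
    discretizationError R f r T α β m n =
      R.quadError (fun x => psi α β m x * otmPrice f r T x) α β n := by
  unfold discretizationError QuadRule.quadError
  congr 1
  exact Finset.sum_congr rfl fun i _ => by ring

theorem cosCoeffEst_sub_cosCoeff {Ω : Type*} (R : QuadRule) (f : ℝ → ℝ) (r T α β : ℝ) (m n : ℕ)
    (ε : ℕ → Ω → ℝ) (ω : Ω) :
    cosCoeffEst R f r T α β m n ε ω - cosCoeff f r T α β m =
      ∑ i ∈ Finset.Icc 1 n,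
        R.weight n i * psi α β m (strike α β n i) * mesh α β n * ε i ω +
      discretizationError R f r T α β m n := by
  unfold cosCoeffEst cosCoeff discretizationError observedPrice
  have : ∑ i ∈ Finset.Icc 1 n, R.weight n i * psi α β m (strike α β n i) *
      (otmPrice f r T (strike α β n i) + ε i ω) * mesh α β n =
      ∑ i ∈ Finset.Icc 1 n, R.weight n i * psi α β m (strike α β n i) * mesh α β n * ε i ω +
      ∑ i ∈ Finset.Icc 1 n, R.weight n i * psi α β m (strike α β n i) *
        otmPrice f r T (strike α β n i) * mesh α β n := by
    rw [← Finset.sum_add_distrib]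
    exact Finset.sum_congr rfl fun i _ => by ring
  rw [this]
  ring

section
variable {Ω : ℕ → Type*} [∀ n, MeasurableSpace (Ω n)] {P : ∀ n, Measure (Ω n)}
  [∀ n, IsProbabilityMeasure (P n)] {ε : ∀ n, ℕ → Ω n → ℝ} {σ : ℕ → ℕ → ℝ}

theorem IsObservationError.integrable (hε : IsObservationError P ε σ) {n i : ℕ}
    (hi : i ∈ Finset.Icc 1 n) : Integrable (ε n i) (P n) :=
  (hε.memLp_four n i hi).integrable (by norm_num)

theorem IsObservationError.bias (hε : IsObservationError P ε σ) (R : QuadRule) (f : ℝ → ℝ)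
    (r T α β : ℝ) (m n : ℕ) :
    Integrable (fun ω => cosCoeffEst R f r T α β m n (ε n) ω - cosCoeff f r T α β m) (P n) ∧
      ∫ ω, (cosCoeffEst R f r T α β m n (ε n) ω - cosCoeff f r T α β m) ∂P n =
        discretizationError R f r T α β m n := by
  simp_rw [cosCoeffEst_sub_cosCoeff]
  have h1 : ∀ i ∈ Finset.Icc 1 n, Integrable (fun ω => R.weight n i *
      psi α β m (strike α β n i) * mesh α β n * ε n i ω) (P n) :=
    fun i hi => (hε.integrable hi).const_mul _
  have h2 := integrable_finsetSum _ h1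
  refine ⟨h2.add (integrable_const _), ?_⟩
  rw [integral_add h2 (integrable_const _), integral_finsetSum _ h1,
    Finset.sum_eq_zero fun i hi => by rw [integral_const_mul, hε.mean_zero n i hi, mul_zero]]
  simp

theorem integral_abs_cube_le {Ω : Type*} [MeasurableSpace Ω] {P : Measure Ω}
    [IsProbabilityMeasure P] {X : Ω → ℝ} (hX : MemLp X 4 P) :
    ∫ ω, |X ω| ^ 3 ∂P ≤ 1 + ∫ ω, X ω ^ 4 ∂P := by
  have hX' : MemLp X (4 : ℕ) P := by exact_mod_cast hX
  have i4 := integrable_pow_of_memLp hX' (k := 4) le_rfl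
  have i3 := integrable_abs_pow_of_memLp hX' (k := 3) (by norm_num)
  have h := integral_mono i3 ((integrable_const 1).add i4) fun ω => by
    have h4 : X ω ^ 4 = |X ω| ^ 4 := (Even.pow_abs (by decide) _).symm
    simp only [Pi.add_apply, h4]
    rcases le_total |X ω| 1 with h | h
    · have := pow_le_one₀ (abs_nonneg (X ω)) h (n := 3)
      have : 0 ≤ |X ω| ^ 4 := by positivity
      linarith
    · have : |X ω| ^ 3 ≤ |X ω| ^ 4 := pow_le_pow_right₀ h (by norm_num)
      linarith
  refine h.trans (le_of_eq ?_)
  simp only [Pi.add_apply]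
  rw [integral_add (integrable_const 1) i4]
  simp

/-- The variance carries `h²` while the weighted sum is only of order `1 / h`, so one factor `h` is
left. -/
theorem QuadRule.HasOrder.exists_mul_mesh_le_estStd_sq {R : QuadRule} (hR : R.HasOrder 1)
    {α β : ℝ} (hα : 0 < α) (hαβ : α < β) {m : ℕ} (hm : 0 < m) {c : ℝ} (hc : 0 < c)
    (hσ : ∀ n, ∀ i ∈ Finset.Icc 1 n, c ≤ σ n i ^ 2) :
    ∃ c' : ℝ, 0 < c' ∧ ∀ᶠ n in atTop ⊓ 𝓟 {n | R.Admissible n},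
      c' * mesh α β n ≤ estStd R α β m n (σ n) ^ 2 := by
  obtain ⟨c₁, h1, hev⟩ := hR.exists_le_sum_weight_sq_psi_sq hα hαβ hm
  refine ⟨c * c₁, by positivity, ?_⟩
  filter_upwards [hev, mem_inf_of_right (mem_principal_self _)] with n hn hadm
  have hh := mesh_pos hαβ (show R.Admissible n from hadm).1
  unfold estStd
  rw [Real.sq_sqrt (Finset.sum_nonneg fun i _ => by positivity)]
  calc c * c₁ * mesh α β n ≤ c * (mesh α β n * ∑ i ∈ Finset.Icc 1 n,
        R.weight n i ^ 2 * psi α β m (strike α β n i) ^ 2) * mesh α β n := by gcongr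
    _ = ∑ i ∈ Finset.Icc 1 n, R.weight n i ^ 2 * psi α β m (strike α β n i) ^ 2 * c *
        mesh α β n ^ 2 := by
        rw [Finset.mul_sum, Finset.mul_sum, Finset.sum_mul]
        exact Finset.sum_congr rfl fun i _ => by ring
    _ ≤ _ := Finset.sum_le_sum fun i hi => by
        gcongr
        exact hσ n i hi

theorem IsObservationError.tendstoInDistribution (hε : IsObservationError P ε σ)
    (hM : UniformMoments P ε σ) {R : QuadRule} (hR : R.HasOrder 1) {f : ℝ → ℝ}
    (hf : IsPriceDensity f) (r T : ℝ) {α β : ℝ} (hα : 0 < α) (hαβ : α < β) {m : ℕ} (hm : 0 < m) :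
    TendstoInDistribution
      (fun n ω => (cosCoeffEst R f r T α β m n (ε n) ω - cosCoeff f r T α β m) /
        estStd R α β m n (σ n))
      (atTop ⊓ 𝓟 {n | R.Admissible n}) (id : ℝ → ℝ) P (gaussianReal 0 1) := by
  obtain ⟨c, M, hc, hcM⟩ := hM
  obtain ⟨c', hc', hlow⟩ := hR.exists_mul_mesh_le_estStd_sq hα hαβ hm hc
    fun n i hi => (hcM n i hi).1
  -- Order one is enough: a bias of `O(h)` is negligible against `σ_D`, which is at least of order
  -- `√h`, without smoothness of `f` or conditions on the kink.
  obtain ⟨C, hC0, hC⟩ := hR.exists_abs_quadError_le_of_le_two hf r T hα hαβ le_rfl (by norm_num)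
  obtain ⟨C₁, hC₁0, hC₁⟩ := exists_abs_psi_le hα hαβ
  set l := atTop ⊓ 𝓟 {n | R.Admissible n} with hl
  set S : ℕ → ℝ := fun n => estStd R α β m n (σ n) with hS
  set a : ℕ → ℕ → ℝ := fun n i => R.weight n i * psi α β m (strike α β n i) * mesh α β n with ha
  have hadm : ∀ᶠ n in l, R.Admissible n := mem_inf_of_right (mem_principal_self _)
  have hmesh : Tendsto (mesh α β) l (𝓝 0) := (tendsto_mesh hαβ).mono_left inf_le_left
  have hsqrt : Tendsto (fun n => √(mesh α β n)) l (𝓝 0) := by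
    have := (Real.continuous_sqrt.tendsto 0).comp hmesh
    rwa [Real.sqrt_zero] at this
  have hSpos : ∀ᶠ n in l, 0 < S n ∧ mesh α β n / S n ≤ √(mesh α β n) / √c' := by
    filter_upwards [hlow, hadm] with n hn hnR
    have hh := mesh_pos hαβ hnR.1
    have h0 : 0 ≤ S n := Real.sqrt_nonneg _
    have h1 : √c' * √(mesh α β n) ≤ S n := by
      rw [← Real.sqrt_mul hc'.le]
      exact Real.sqrt_le_iff.mpr ⟨h0, hn⟩
    have h2 : 0 < √c' := Real.sqrt_pos.mpr hc'
    have h3 : 0 < √(mesh α β n) := Real.sqrt_pos.mpr hh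
    have h4 : 0 < S n := lt_of_lt_of_le (by positivity) h1
    refine ⟨h4, ?_⟩
    rw [div_le_div_iff₀ h4 h2]
    calc mesh α β n * √c' = √(mesh α β n) * (√c' * √(mesh α β n)) := by
          nth_rw 1 [← Real.mul_self_sqrt hh.le]; ring
      _ ≤ _ := by gcongr
  have hfun : (fun n ω => (cosCoeffEst R f r T α β m n (ε n) ω - cosCoeff f r T α β m) / S n) =
      fun n ω => ∑ i : Finset.Icc 1 n, a n i / S n * ε n i ω +
        discretizationError R f r T α β m n / S n := by
    ext n ω
    rw [cosCoeffEst_sub_cosCoeff, add_div, Finset.sum_div,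
      Finset.sum_coe_sort (Finset.Icc 1 n) fun i => a n i / S n * ε n i ω]
    congr 1
    exact Finset.sum_congr rfl fun i _ => by ring
  rw [hfun]
  refine tendstoInDistribution_sum_add_of_lyapunov P
    (fun n (i : Finset.Icc 1 n) ω => a n i / S n * ε n i ω) _ ?_ ?_ ?_ ?_ ?_ ?_
  · exact fun n i => ((hε.memLp_four n i i.2).mono_exponent (by norm_num)).const_mul _
  · intro n i
    rw [integral_const_mul, hε.mean_zero n i i.2, mul_zero]
  · exact fun n => (hε.indep n).comp (fun i x => a n i / S n * x) fun i => by fun_prop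
  · filter_upwards [hSpos] with n hn
    simp_rw [mul_pow, integral_const_mul]
    rw [Finset.sum_coe_sort (Finset.Icc 1 n) fun i => (a n i / S n) ^ 2 * ∫ ω, ε n i ω ^ 2 ∂P n]
    have h1 : S n ^ 2 = ∑ i ∈ Finset.Icc 1 n, a n i ^ 2 * ∫ ω, ε n i ω ^ 2 ∂P n := by
      rw [hS]
      unfold estStd
      rw [Real.sq_sqrt (Finset.sum_nonneg fun i _ => by positivity)]
      refine Finset.sum_congr rfl fun i hi => ?_
      rw [hε.second_moment n i hi, ha]
      ring
    simp_rw [div_pow, div_mul_eq_mul_div]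
    rw [← Finset.sum_div, ← h1, div_self (pow_ne_zero 2 hn.1.ne')]
  · set A := R.coeffBound * (C₁ * (m : ℝ) ^ 2) with hA
    have hA0 : 0 ≤ A := by have := R.coeffBound_nonneg; positivity
    -- `2 (β - α)` bounds `n h`, which absorbs the number of summands and leaves `√h` from
    -- `h^{3/2}`.
    set D := 2 * (β - α) * ((A / √c') ^ 3 * (1 + |M|)) with hD
    have hlim : Tendsto (fun n => D * √(mesh α β n)) l (𝓝 0) := by simpa using hsqrt.const_mul D
    refine squeeze_zero' (Eventually.of_forall fun n => Finset.sum_nonneg fun i _ =>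
      integral_nonneg fun ω => by positivity) ?_ hlim
    filter_upwards [hSpos, hadm] with n hn hnR
    have hh := mesh_pos hαβ hnR.1
    simp_rw [abs_mul, mul_pow, integral_const_mul]
    rw [Finset.sum_coe_sort (Finset.Icc 1 n)
      fun i => |a n i / S n| ^ 3 * ∫ ω, |ε n i ω| ^ 3 ∂P n]
    have hn2 : n * mesh α β n ≤ 2 * (β - α) := by
      have h2 : (0 : ℝ) < n := by have := hnR.1; positivity
      have := mesh_le hαβ hnR.1
      rwa [le_div_iff₀ h2, mul_comm] at this
    calc _ ≤ ∑ i ∈ Finset.Icc 1 n, (A * (√(mesh α β n) / √c')) ^ 3 * (1 + |M|) := by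
          refine Finset.sum_le_sum fun i hi => ?_
          gcongr
          · rw [abs_div, abs_of_pos hn.1]
            calc |a n i| / S n ≤ A * mesh α β n / S n := by
                  rw [ha]
                  simp only [abs_mul]
                  rw [abs_of_pos hh]
                  have := hn.1
                  gcongr
                  exact mul_le_mul (R.abs_weight_le n i)
                    (hC₁ m hm _ (strike_mem_Icc hαβ hnR.1 hi)) (abs_nonneg _) R.coeffBound_nonneg
              _ = A * (mesh α β n / S n) := by ring
              _ ≤ _ := mul_le_mul_of_nonneg_left hn.2 hA0
          · exact (integral_abs_cube_le (hε.memLp_four n i hi)).trans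
              (by have := (hcM n i hi).2; have := le_abs_self M; linarith)
      _ = n * √(mesh α β n) ^ 2 * ((A / √c') ^ 3 * (1 + |M|)) * √(mesh α β n) := by
          rw [Finset.sum_const, Nat.card_Icc, nsmul_eq_mul, Nat.add_sub_cancel]
          ring
      _ ≤ _ := by
          rw [Real.sq_sqrt hh.le, hD]
          gcongr
  · have hlim : Tendsto (fun n => C * (m : ℝ) ^ 3 / √c' * √(mesh α β n)) l (𝓝 0) := by
      simpa using hsqrt.const_mul (C * (m : ℝ) ^ 3 / √c')
    refine squeeze_zero_norm' ?_ hlim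
    filter_upwards [hSpos, hadm] with n hn hnR
    rw [norm_div, Real.norm_eq_abs, Real.norm_eq_abs, abs_of_pos hn.1,
      discretizationError_eq_quadError]
    have h1 := hC m n hm hnR
    rw [pow_one] at h1
    have := hn.1
    calc _ ≤ C * (m : ℝ) ^ (2 + 1) * mesh α β n / S n := by gcongr
      _ = C * (m : ℝ) ^ 3 * (mesh α β n / S n) := by ring
      _ ≤ C * (m : ℝ) ^ 3 * (√(mesh α β n) / √c') :=
          mul_le_mul_of_nonneg_left hn.2 (by positivity)
      _ = _ := by ring

end

theorem QuadRule.HasOrder.exists_abs_discretizationError_le {R : QuadRule} {ι : ℕ} (hι : 1 ≤ ι)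
    (hR : R.HasOrder ι) {f : ℝ → ℝ} (hf : IsPriceDensity f) (r T : ℝ) {α β : ℝ} (hα : 0 < α)
    (hαβ : α < β) (hfι : 2 < ι → ContDiffOn ℝ (ι - 2 : ℕ) f (Set.Icc α β)) :
    ∃ C : ℝ, ∀ m n : ℕ, 0 < m → R.Admissible n →
      (2 < ι → futuresPrice f ∈ Set.Ioo α β →
        ∃ k : ℕ, futuresPrice f = strike α β n (k * R.p + 1)) →
      |discretizationError R f r T α β m n| ≤ C * ((m : ℝ) ^ (2 + ι) / (n : ℝ) ^ ι) := by
  obtain ⟨C, hC0, hC⟩ : ∃ C : ℝ, 0 ≤ C ∧ ∀ m n : ℕ, 0 < m → R.Admissible n →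
      (2 < ι → futuresPrice f ∈ Set.Ioo α β →
        ∃ k : ℕ, futuresPrice f = strike α β n (k * R.p + 1)) →
      |R.quadError (fun x => psi α β m x * otmPrice f r T x) α β n| ≤
        C * (m : ℝ) ^ (2 + ι) * mesh α β n ^ ι := by
    rcases le_or_gt ι 2 with h | h
    · obtain ⟨C, hC0, hC⟩ := hR.exists_abs_quadError_le_of_le_two hf r T hα hαβ hι h
      exact ⟨C, hC0, fun m n hm hn _ => hC m n hm hn⟩
    · obtain ⟨C, hC0, hC⟩ := hR.exists_abs_quadError_le_of_contDiffOn hf r T hα hαβ h (hfι h)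
      exact ⟨C, hC0, fun m n hm hn hF => hC m n hm hn (hF h)⟩
  refine ⟨C * (2 * (β - α)) ^ ι, fun m n hm hn hF => ?_⟩
  rw [discretizationError_eq_quadError]
  have hh := mesh_pos hαβ hn.1
  calc _ ≤ C * (m : ℝ) ^ (2 + ι) * mesh α β n ^ ι := hC m n hm hn hF
    _ ≤ C * (m : ℝ) ^ (2 + ι) * (2 * (β - α) / n) ^ ι := by
        gcongr
        exact mesh_le hαβ hn.1
    _ = _ := by rw [div_pow]; ring

theorem proposition2
    -- risk-neutral density, interest rate, maturity, strike range
    (f : ℝ → ℝ) (hf : IsPriceDensity f) (r T α β : ℝ) (hT : 0 < T) (hα : 0 < α) (hαβ : α < β)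
    -- numerical integration scheme of order `ι`
    (R : QuadRule) (ι : ℕ) (hι : 1 ≤ ι) (hR : R.HasOrder ι)
    -- observation errors
    {Ω : ℕ → Type*} [∀ n, MeasurableSpace (Ω n)] (P : ∀ n, Measure (Ω n))
    [∀ n, IsProbabilityMeasure (P n)] (ε : ∀ n, ℕ → Ω n → ℝ) (σ : ℕ → ℕ → ℝ)
    (hε : IsObservationError P ε σ) :
    -- the bias is the discretization error
    (∀ m n : ℕ, 0 < m → R.Admissible n →
      Integrable (fun ω => cosCoeffEst R f r T α β m n (ε n) ω - cosCoeff f r T α β m) (P n) ∧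
      ∫ ω, (cosCoeffEst R f r T α β m n (ε n) ω - cosCoeff f r T α β m) ∂P n =
        discretizationError R f r T α β m n) ∧
    -- the discretization error is `O(m ^ (2 + ι) / n ^ ι)`; orders above two need smoothness of the
    -- density, and the kink of the out-of-the-money price must not lie inside a panel
    ((2 < ι → ContDiffOn ℝ (ι - 2 : ℕ) f (Set.Icc α β)) →
      ∃ C : ℝ, ∀ m n : ℕ, 0 < m → R.Admissible n →
        (2 < ι → futuresPrice f ∈ Set.Ioo α β →
          ∃ k : ℕ, futuresPrice f = strike α β n (k * R.p + 1)) →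
        |discretizationError R f r T α β m n| ≤ C * ((m : ℝ) ^ (2 + ι) / (n : ℝ) ^ ι)) ∧
    -- asymptotic normality of the standardized error, as `n → ∞`
    (UniformMoments P ε σ →
      ∀ m : ℕ, 0 < m →
        TendstoInDistribution
          (fun n ω => (cosCoeffEst R f r T α β m n (ε n) ω - cosCoeff f r T α β m) /
            estStd R α β m n (σ n))
          (atTop ⊓ 𝓟 {n | R.Admissible n}) (id : ℝ → ℝ) P (gaussianReal 0 1)) := by
  refine ⟨fun m n _ _ => hε.bias R f r T α β m n, fun hfι =>
    hR.exists_abs_discretizationError_le hι hf r T hα hαβ hfι, fun hM m hm =>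
    hε.tendstoInDistribution hM (hR.mono hι) hf r T hα hαβ hm⟩
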